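/- **Theorem 1 (Equivalence of the approximate GKP code states).** Consider one bosonic mode with Hilbert space $L^2(\mathbb R)$ (position wave functions), $(\hat q\psi)(x)=x\psi(x)$, $\hat p=-i\,d/dx$, $\hat a=(\hat q+i\hat p)/\sqrt2$, $\hat n=\hat a^\dagger\hat a$, $\hat X(r)=e^{-ir\hat p}$, $\hat Z(r)=e^{ir\hat q}$, $\hat V(r_1,r_2)=e^{-ir_1r_2/2}\hat Z(r_1)\hat X(r_2)$, $\hat S(\xi)=e^{i\xi(\hat q\hat p+\hat p\hat q)/2}$ (so that $(\hat S(\xi)\psi)(x)=e^{\xi/2}\psi(e^{\xi}x)$), and Fock states $|n\rangle_f$, where $|0\rangle_f$ has the wave function $\pi^{-1/4}e^{-x^2/2}$. Let $d\ge1$, $j\in\{0,\dots,d-1\}$, $\alpha_d=\sqrt{2\pi/d}$, and let $$|j^{(\mathrm{ideal})}\rangle=\sqrt{\alpha_d d}\sum_{s\in\mathbb Z}|\alpha_d(ds+j)\rangle_{\hat q}$$ be the (tempered-distribution) square-lattice ideal code state, where $|y\rangle_{\hat q}$ is the Dirac delta at $y$. With positive normalization constants $N$ that make the states unit vectors, define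 $$|j^{(1)}_{\kappa,\Delta}\rangle=\frac1{\sqrt{N^{(1)}_{\kappa,\Delta,j}}}\sum_{s\in\mathbb Z}e^{-\frac12\kappa^2\alpha_d^2(ds+j)^2}\hat X(\alpha_d(ds+j))\hat S(-\ln\Delta)|0\rangle_f\qquad(\kappa,\Delta>0),$$ $$|j^{(2)}_{\gamma,\delta}\rangle=\frac1{\sqrt{N^{(2)}_{\gamma,\delta,j}}}\iint\frac{dr_1dr_2}{2\pi\gamma\delta}\,e^{-\frac{r_1^2}{2\gamma^2}-\frac{r_2^2}{2\delta^2}}\hat V(r_1,r_2)|j^{(\mathrm{ideal})}\rangle\qquad(0<\gamma\delta<2),$$ $$|j^{(3)}_\beta\rangle=\frac1{\sqrt{N^{(3)}_{\beta,j}}}e^{-\beta(\hat n+\frac12)}|j^{(\mathrm{ideal})}\rangle\qquad(\beta>0),$$ where the integral is understood weakly, that is, tested against Schwartz functions, and $e^{-\beta(\hat n+1/2)}$ acts diagonally in the Fock basis. Put $\lambda(\gamma,\delta)=1+\gamma^2\delta^2/4$. Let $\beta>0$, and let $\kappa,\Delta>0$ and real $\gamma,\delta$ with $\gamma\delta>0$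 satisfy $$\gamma^2=\delta^2=2\tanh\frac\beta2,\qquad \kappa^2=\frac{\gamma^2}{\lambda(\gamma,\delta)},\qquad \Delta^2=\frac{\delta^2}{\lambda(\gamma,\delta)}\Bigl(1-\frac{\gamma^2\delta^2}{2\lambda(\gamma,\delta)}\Bigr)^{-2}.$$ Then $\gamma\delta<2$, $\kappa^2=\tanh\beta$ and $\Delta^2=\sinh\beta\cosh\beta$; the series defining the ideal state converges in the space of tempered distributions; all three approximate states are well defined unit vectors of $L^2(\mathbb R)$ (the series and the weak integral converge, and the sums and the integral are non-zero vectors of $L^2(\mathbb R)$); and $$\hat S\!\left(\ln\sqrt{1+\kappa^2\Delta^2}\right)|j^{(1)}_{\kappa,\Delta}\rangle=|j^{(2)}_{\gamma,\delta}\rangle=|j^{(3)}_\beta\rangle .$$ -/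

import Mathlib

open MeasureTheory Filter Topology
open scoped SchwartzMap ENNReal

noncomputable section

namespace GKP

/-! ### One bosonic mode in the position representation

The Hilbert space is `L²(ℝ; ℂ)`, a vector being its position wave function. Generalized
(non-normalizable) kets are tempered distributions: the ket with formal wave function `T(x)`
is the functional `f ↦ ∫ T(x) f(x) dx`. -/

/-- The Hilbert space of one mode. -/
abbrev H : Type := Lp ℂ 2 (volume : Measure ℝ)

/-- A Schwartz function as a vector of the Hilbert space. -/
def ket (f : 𝓢(ℝ, ℂ)) : H := f.toLp 2

/-! ### Canonical operators on the Schwartz space -/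

/-- The position operator `(q̂ f)(x) = x f(x)`. -/
def posOp : 𝓢(ℝ, ℂ) →L[ℂ] 𝓢(ℝ, ℂ) := SchwartzMap.smulLeftCLM ℂ (fun x : ℝ => (x : ℂ))

/-- The momentum operator `p̂ f = -i f'`. -/
def momOp : 𝓢(ℝ, ℂ) →L[ℂ] 𝓢(ℝ, ℂ) := (-Complex.I) • SchwartzMap.derivCLM ℂ ℂ

/-- The annihilation operator `â = (q̂ + i p̂)/√2`. -/
def annOp : 𝓢(ℝ, ℂ) →L[ℂ] 𝓢(ℝ, ℂ) :=
  ((Real.sqrt 2 : ℝ) : ℂ)⁻¹ • (posOp + Complex.I • momOp)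

/-- The creation operator `â† = (q̂ - i p̂)/√2`. -/
def creOp : 𝓢(ℝ, ℂ) →L[ℂ] 𝓢(ℝ, ℂ) :=
  ((Real.sqrt 2 : ℝ) : ℂ)⁻¹ • (posOp - Complex.I • momOp)

/-- The number operator `n̂ = â† â`. -/
def numOp : 𝓢(ℝ, ℂ) →L[ℂ] 𝓢(ℝ, ℂ) := creOp ∘L annOp

theorem posOp_apply (f : 𝓢(ℝ, ℂ)) (x : ℝ) : posOp f x = x * f x := by
  have h : (fun x : ℝ => (x : ℂ)).HasTemperateGrowth := by fun_prop
  rw [posOp, SchwartzMap.smulLeftCLM_apply_apply h, smul_eq_mul]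

theorem momOp_apply (f : 𝓢(ℝ, ℂ)) (x : ℝ) : momOp f x = -Complex.I * deriv f x := by
  simp [momOp]

theorem deriv_posOp (f : 𝓢(ℝ, ℂ)) (x : ℝ) : deriv (posOp f) x = f x + x * deriv f x := by
  have h1 : (posOp f : ℝ → ℂ) = Complex.ofRealCLM * f := funext (posOp_apply f)
  rw [h1, ((Complex.ofRealCLM.hasDerivAt (x := x)).mul f.differentiableAt.hasDerivAt).deriv]
  simp

/-! ### Displacements and squeezing -/

/-- `X̂(r) = exp(-i r p̂)` on the Schwartz space: `(X̂(r) f)(x) = f(x - r)`. -/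
def dispX (r : ℝ) : 𝓢(ℝ, ℂ) →L[ℂ] 𝓢(ℝ, ℂ) := SchwartzMap.compSubConstCLM ℂ r

/-- `Ẑ(r) = exp(i r q̂)` on the Schwartz space: `(Ẑ(r) f)(x) = e^{i r x} f(x)`. -/
def dispZ (r : ℝ) : 𝓢(ℝ, ℂ) →L[ℂ] 𝓢(ℝ, ℂ) :=
  SchwartzMap.smulLeftCLM ℂ (fun x : ℝ => Complex.exp (Complex.I * r * x))

/-- `Ŝ(ξ) = exp(i ξ (q̂ p̂ + p̂ q̂)/2)` on the Schwartz space: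
`(Ŝ(ξ) f)(x) = e^{ξ/2} f(e^ξ x)`. -/
def squeeze (ξ : ℝ) : 𝓢(ℝ, ℂ) →L[ℂ] 𝓢(ℝ, ℂ) :=
  ((Real.exp (ξ / 2) : ℝ) : ℂ) • SchwartzMap.compCLMOfContinuousLinearEquiv ℂ
    (ContinuousLinearEquiv.unitsEquivAut ℝ (Units.mk0 (Real.exp ξ) (Real.exp_ne_zero ξ)))

theorem dispX_apply (r : ℝ) (f : 𝓢(ℝ, ℂ)) (x : ℝ) : dispX r f x = f (x - r) := by
  simp [dispX]

theorem hasTemperateGrowth_phase (r : ℝ) :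
    (fun x : ℝ => Complex.exp (Complex.I * r * x)).HasTemperateGrowth := by
  have hd : deriv (fun x : ℝ => Complex.exp (Complex.I * r * x)) =
      fun x : ℝ => (Complex.I * r) * Complex.exp (Complex.I * r * x) := by
    funext x
    have h1 : HasDerivAt (fun y : ℝ => Complex.I * r * (y : ℂ)) (Complex.I * r) x := by
      simpa using (Complex.ofRealCLM.hasDerivAt (x := x)).const_mul (Complex.I * (r : ℂ))
    rw [h1.cexp.deriv, mul_comm]
  have hn : ∀ n : ℕ, iteratedDeriv n (fun x : ℝ => Complex.exp (Complex.I * r * x)) =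
      fun x : ℝ => (Complex.I * r) ^ n * Complex.exp (Complex.I * r * x) := by
    intro n
    induction n with
    | zero => simp
    | succ n ih =>
      rw [iteratedDeriv_succ, ih]
      funext x
      rw [deriv_const_mul_field, hd]
      ring
  refine ⟨(contDiff_const.mul Complex.ofRealCLM.contDiff).cexp, fun n => ⟨0, |r| ^ n, fun x => ?_⟩⟩
  rw [norm_iteratedFDeriv_eq_norm_iteratedDeriv, hn]
  have : Complex.I * r * x = ((r * x : ℝ) : ℂ) * Complex.I := by push_cast; ring
  simp [this, Complex.norm_exp_ofReal_mul_I, -Complex.ofReal_mul]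

theorem dispZ_apply (r : ℝ) (f : 𝓢(ℝ, ℂ)) (x : ℝ) :
    dispZ r f x = Complex.exp (Complex.I * r * x) * f x := by
  rw [dispZ, SchwartzMap.smulLeftCLM_apply_apply (hasTemperateGrowth_phase r), smul_eq_mul]

theorem squeeze_apply (ξ : ℝ) (f : 𝓢(ℝ, ℂ)) (x : ℝ) :
    squeeze ξ f x = (Real.exp (ξ / 2) : ℝ) * f (Real.exp ξ * x) := by
  simp [squeeze, mul_comm]

/-- `X̂` is the group generated by `-i p̂`. -/
theorem hasDerivAt_dispX (f : 𝓢(ℝ, ℂ)) (r x : ℝ) :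
    HasDerivAt (fun t : ℝ => dispX t f x) (-Complex.I * momOp (dispX r f) x) r := by
  have h1 : HasDerivAt f (deriv f (x - r)) (x - r) := f.differentiableAt.hasDerivAt
  have h2 : HasDerivAt (fun t : ℝ => x - t) (-1) r := by
    simpa using (hasDerivAt_id r).const_sub x
  have h3 := h1.scomp r h2
  have h4 : deriv (dispX r f) x = deriv f (x - r) := by
    have : (dispX r f : ℝ → ℂ) = fun y => f (y - r) := funext (dispX_apply r f)
    rw [this, deriv_comp_sub_const]
  have h5 : (fun t : ℝ => dispX t f x) = f ∘ fun t => x - t := by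
    funext t
    exact dispX_apply t f x
  rw [momOp_apply, h4, h5]
  refine h3.congr_deriv ?_
  rw [← mul_assoc]
  simp

/-- `Ẑ` is the group generated by `i q̂`. -/
theorem hasDerivAt_dispZ (f : 𝓢(ℝ, ℂ)) (r x : ℝ) :
    HasDerivAt (fun t : ℝ => dispZ t f x) (Complex.I * posOp (dispZ r f) x) r := by
  have h1 : HasDerivAt (fun y : ℝ => Complex.I * (y : ℂ) * (x : ℂ)) (Complex.I * x) r := by
    simpa using
      ((Complex.ofRealCLM.hasDerivAt (x := r)).const_mul Complex.I).mul_const (x : ℂ)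
  have h2 := h1.cexp.mul_const (f x)
  have h3 : (fun t : ℝ => dispZ t f x) = fun t : ℝ => Complex.exp (Complex.I * t * x) * f x :=
    funext fun t => dispZ_apply t f x
  rw [posOp_apply, dispZ_apply, h3]
  refine h2.congr_deriv ?_
  ring

/-- `Ŝ` is the group generated by `i (q̂ p̂ + p̂ q̂)/2`. -/
theorem hasDerivAt_squeeze (f : 𝓢(ℝ, ℂ)) (ξ x : ℝ) :
    HasDerivAt (fun t : ℝ => squeeze t f x)
      (Complex.I * ((posOp (momOp (squeeze ξ f)) + momOp (posOp (squeeze ξ f))) x / 2)) ξ := by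
  have he : ∀ t : ℝ, HasDerivAt (fun t : ℝ => ((Real.exp (t / 2) : ℝ) : ℂ))
      (((Real.exp (t / 2) * (1 / 2) : ℝ)) : ℂ) t := fun t =>
    (((hasDerivAt_id t).div_const 2).exp).ofReal_comp
  have h1 : HasDerivAt (fun t : ℝ => Real.exp t * x) (Real.exp ξ * x) ξ :=
    (Real.hasDerivAt_exp ξ).mul_const x
  have h2 : HasDerivAt f (deriv f (Real.exp ξ * x)) (Real.exp ξ * x) :=
    f.differentiableAt.hasDerivAt
  have h3 := (he ξ).mul (h2.scomp ξ h1)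
  have hs : ∀ y, HasDerivAt (squeeze ξ f)
      ((Real.exp (ξ / 2) : ℝ) * (Real.exp ξ • deriv f (Real.exp ξ * y))) y := by
    intro y
    have a1 : HasDerivAt (fun t : ℝ => Real.exp ξ * t) (Real.exp ξ) y := by
      simpa using (hasDerivAt_id y).const_mul (Real.exp ξ)
    have a2 : HasDerivAt f (deriv f (Real.exp ξ * y)) (Real.exp ξ * y) :=
      f.differentiableAt.hasDerivAt
    have a3 := (a2.scomp y a1).const_mul ((Real.exp (ξ / 2) : ℝ) : ℂ)
    have : (squeeze ξ f : ℝ → ℂ) =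
        fun y => ((Real.exp (ξ / 2) : ℝ) : ℂ) * (f ∘ fun t => Real.exp ξ * t) y :=
      funext (squeeze_apply ξ f)
    rw [this]
    exact a3
  have hq : deriv (posOp (squeeze ξ f)) x = squeeze ξ f x + x * deriv (squeeze ξ f) x :=
    deriv_posOp _ x
  have h5 : (fun t : ℝ => squeeze t f x) =
      fun t => ((Real.exp (t / 2) : ℝ) : ℂ) * (f ∘ fun t => Real.exp t * x) t :=
    funext fun t => squeeze_apply t f x
  rw [add_apply, posOp_apply, momOp_apply, momOp_apply, hq, (hs x).deriv, h5]
  refine h3.congr_deriv ?_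
  rw [squeeze_apply]
  simp only [Function.comp_apply, Complex.real_smul]
  push_cast
  linear_combination (Complex.exp (ξ / 2) * f (Real.exp ξ * x) / 2 +
    Complex.exp (ξ / 2) * Complex.exp ξ * x * deriv f (Real.exp ξ * x)) * Complex.I_sq

theorem memLp_squeeze (ξ : ℝ) (ψ : H) :
    MemLp (fun x : ℝ => ((Real.exp (ξ / 2) : ℝ) : ℂ) * ψ (Real.exp ξ * x)) 2 volume := by
  have h1 : MemLp ψ 2 (Measure.map (fun x : ℝ => Real.exp ξ * x) volume) := by
    rw [Real.map_volume_mul_left (Real.exp_ne_zero ξ)]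
    exact (Lp.memLp ψ).smul_measure ENNReal.ofReal_ne_top
  exact (h1.comp_of_map (by fun_prop)).const_mul _

/-- The unitary squeezing operator on the Hilbert space, `(Ŝ(ξ) ψ)(x) = e^{ξ/2} ψ(e^ξ x)`. -/
def squeezeH (ξ : ℝ) (ψ : H) : H := (memLp_squeeze ξ ψ).toLp _

theorem squeezeH_ket (ξ : ℝ) (f : 𝓢(ℝ, ℂ)) : squeezeH ξ (ket f) = ket (squeeze ξ f) := by
  have hq : Measure.QuasiMeasurePreserving (fun x : ℝ => Real.exp ξ * x) volume volume :=
    ⟨by fun_prop, by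
      rw [Real.map_volume_mul_left (Real.exp_ne_zero ξ)]
      exact Measure.smul_absolutelyContinuous⟩
  have h := hq.ae_eq_comp (SchwartzMap.coeFn_toLp f 2 volume)
  refine Lp.ext ?_
  filter_upwards [(memLp_squeeze ξ (ket f)).coeFn_toLp,
    SchwartzMap.coeFn_toLp (squeeze ξ f) 2 volume, h] with x h1 h2 h3
  simp only [Function.comp_apply] at h3
  rw [squeezeH, h1, ket, ket, h2, squeeze_apply, h3]

theorem norm_squeezeH (ξ : ℝ) (ψ : H) : ‖squeezeH ξ ψ‖ = ‖ψ‖ := by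
  have hae : AEStronglyMeasurable (ψ : ℝ → ℂ)
      (Measure.map (fun x : ℝ => Real.exp ξ * x) volume) := by
    rw [Real.map_volume_mul_left (Real.exp_ne_zero ξ)]
    exact (Lp.aestronglyMeasurable ψ).smul_measure _
  have h := eLpNorm_map_measure (p := 2) hae (by fun_prop)
  rw [Real.map_volume_mul_left (Real.exp_ne_zero ξ),
    eLpNorm_smul_measure_of_ne_top (by norm_num)] at h
  rw [squeezeH, Lp.norm_toLp, Lp.norm_def]
  have h' : eLpNorm (fun x : ℝ => ((Real.exp (ξ / 2) : ℝ) : ℂ) * ψ (Real.exp ξ * x)) 2 volume =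
      ‖((Real.exp (ξ / 2) : ℝ) : ℂ)‖ₑ *
        eLpNorm ((ψ : ℝ → ℂ) ∘ fun x : ℝ => Real.exp ξ * x) 2 volume :=
    eLpNorm_const_smul ((Real.exp (ξ / 2) : ℝ) : ℂ)
      ((ψ : ℝ → ℂ) ∘ fun x : ℝ => Real.exp ξ * x) 2 volume
  rw [h', ← h, smul_eq_mul, ENNReal.toReal_mul, ENNReal.toReal_mul, ← ENNReal.toReal_rpow,
    ENNReal.toReal_ofReal (abs_nonneg _), abs_of_pos (by positivity), ← mul_assoc]
  have : (‖((Real.exp (ξ / 2) : ℝ) : ℂ)‖ₑ).toReal * (Real.exp ξ)⁻¹ ^ (1 / (2 : ℝ≥0∞)).toReal = 1 := by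
    rw [toReal_enorm, Complex.norm_real, Real.norm_of_nonneg (Real.exp_pos _).le,
      ← Real.exp_neg, ← Real.exp_mul, ← Real.exp_add]
    simp
    ring
  rw [this, one_mul]

/-- `X̂(r)` on tempered distributions, the transpose of `X̂(-r)`; formally `T(x) ↦ T(x - r)`. -/
def dispXDist (r : ℝ) : 𝓢'(ℝ, ℂ) →L[ℂ] 𝓢'(ℝ, ℂ) :=
  PointwiseConvergenceCLM.precomp ℂ (dispX (-r))

/-- `Ẑ(r)` on tempered distributions, its own transpose; formally `T(x) ↦ e^{i r x} T(x)`. -/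
def dispZDist (r : ℝ) : 𝓢'(ℝ, ℂ) →L[ℂ] 𝓢'(ℝ, ℂ) :=
  PointwiseConvergenceCLM.precomp ℂ (dispZ r)

/-- The Weyl-Heisenberg displacement `V̂(r) = exp(-i r_p r_q / 2) Ẑ(r_p) X̂(r_q)`,
`r = (r_p, r_q)`, on tempered distributions. -/
def dispV (r : ℝ × ℝ) : 𝓢'(ℝ, ℂ) →L[ℂ] 𝓢'(ℝ, ℂ) :=
  Complex.exp (-Complex.I * r.1 * r.2 / 2) • (dispZDist r.1 ∘L dispXDist r.2)

/-! ### Fock states -/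

theorem gaussian_decay (k n : ℕ) : ∃ C : ℝ, ∀ x : ℝ,
    ‖x‖ ^ k * ‖iteratedFDeriv ℝ n (fun y : ℝ => Real.exp (-(y ^ 2 / 2))) x‖ ≤ C := by
  have hb : ∀ m : ℕ, ∃ C : ℝ, ∀ x : ℝ, |x| ^ m * Real.exp (-(x ^ 2 / 2)) ≤ C := by
    intro m
    refine ⟨1 + 2 ^ m * m.factorial, fun x => ?_⟩
    have h1 : |x| ^ m ≤ 1 + (x ^ 2) ^ m := by
      rw [← sq_abs, ← pow_mul, mul_comm 2 m, pow_mul]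
      nlinarith [sq_nonneg (|x| ^ m - 1), sq_nonneg (|x| ^ m)]
    have h2 : (x ^ 2) ^ m ≤ 2 ^ m * m.factorial * Real.exp (x ^ 2 / 2) := by
      have := Real.pow_div_factorial_le_exp (x ^ 2 / 2) (by positivity) m
      rw [div_pow, div_div, div_le_iff₀ (by positivity)] at this
      linarith
    have h3 : Real.exp (x ^ 2 / 2) * Real.exp (-(x ^ 2 / 2)) = 1 := by
      rw [← Real.exp_add]; simp
    have h4 : Real.exp (-(x ^ 2 / 2)) ≤ 1 := by
      rw [Real.exp_le_one_iff]; linarith [sq_nonneg x]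
    have h5 : 0 < Real.exp (-(x ^ 2 / 2)) := Real.exp_pos _
    calc |x| ^ m * Real.exp (-(x ^ 2 / 2))
        ≤ (1 + 2 ^ m * m.factorial * Real.exp (x ^ 2 / 2)) * Real.exp (-(x ^ 2 / 2)) := by
          gcongr; linarith
      _ = Real.exp (-(x ^ 2 / 2)) + 2 ^ m * m.factorial := by
          rw [add_mul, mul_assoc, h3]; ring
      _ ≤ _ := by linarith
  choose C hC using hb
  refine ⟨∑ i ∈ Finset.range ((Polynomial.hermite n).natDegree + 1),
    |((Polynomial.hermite n).coeff i : ℝ)| * C (k + i), fun x => ?_⟩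
  rw [norm_iteratedFDeriv_eq_norm_iteratedDeriv, iteratedDeriv_eq_iterate,
    Polynomial.deriv_gaussian_eq_hermite_mul_gaussian, norm_mul, norm_mul, norm_pow, norm_neg,
    norm_one, one_pow, one_mul, Real.norm_of_nonneg (Real.exp_pos _).le,
    Polynomial.aeval_eq_sum_range, Real.norm_eq_abs]
  calc |x| ^ k * (‖∑ i ∈ Finset.range ((Polynomial.hermite n).natDegree + 1),
          (Polynomial.hermite n).coeff i • x ^ i‖ * Real.exp (-(x ^ 2 / 2)))
      ≤ |x| ^ k * ((∑ i ∈ Finset.range ((Polynomial.hermite n).natDegree + 1),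
          |((Polynomial.hermite n).coeff i : ℝ)| * |x| ^ i) * Real.exp (-(x ^ 2 / 2))) := by
        gcongr
        refine (norm_sum_le _ _).trans (le_of_eq (Finset.sum_congr rfl fun i _ => ?_))
        rw [zsmul_eq_mul, norm_mul, norm_pow, Real.norm_eq_abs, Real.norm_eq_abs]
    _ = ∑ i ∈ Finset.range ((Polynomial.hermite n).natDegree + 1),
          |((Polynomial.hermite n).coeff i : ℝ)| *
            (|x| ^ (k + i) * Real.exp (-(x ^ 2 / 2))) := by
        rw [Finset.sum_mul, Finset.mul_sum]
        exact Finset.sum_congr rfl fun i _ => by rw [pow_add]; ring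
    _ ≤ _ := by
        gcongr with i
        exact hC (k + i) x

/-- The Gaussian `e^{-x²/2}` as a Schwartz function. -/
def gaussian : 𝓢(ℝ, ℝ) where
  toFun y := Real.exp (-(y ^ 2 / 2))
  smooth' := by fun_prop
  decay' := gaussian_decay

/-- The vacuum `|0⟩_f`, with wave function `π^{-1/4} e^{-x²/2}`. -/
def vacuum : 𝓢(ℝ, ℂ) :=
  ((Real.pi ^ (-(1 / 4) : ℝ) : ℝ) : ℂ) • SchwartzMap.postcompCLM (𝕜 := ℝ) Complex.ofRealCLM gaussian

theorem vacuum_apply (x : ℝ) :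
    vacuum x = ((Real.pi ^ (-(1 / 4) : ℝ) * Real.exp (-(x ^ 2 / 2)) : ℝ) : ℂ) := by
  have h : gaussian x = Real.exp (-(x ^ 2 / 2)) := rfl
  simp [vacuum, h]

/-- The Fock state `|n⟩_f = (n!)^{-1/2} (â†)^n |0⟩_f`. -/
def fock (n : ℕ) : 𝓢(ℝ, ℂ) :=
  ((Real.sqrt n.factorial : ℝ) : ℂ)⁻¹ • (creOp^[n]) vacuum

theorem annOp_vacuum : annOp vacuum = 0 := by
  ext x
  have h : HasDerivAt (fun y : ℝ => Real.pi ^ (-(1 / 4) : ℝ) * Real.exp (-(y ^ 2 / 2)))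
      (Real.pi ^ (-(1 / 4) : ℝ) * (Real.exp (-(x ^ 2 / 2)) * -x)) x := by
    have := (((hasDerivAt_pow 2 x).div_const 2).neg.exp).const_mul (Real.pi ^ (-(1 / 4) : ℝ))
    refine this.congr_deriv ?_
    simp
  have hv : (vacuum : ℝ → ℂ) =
      fun y => ((Real.pi ^ (-(1 / 4) : ℝ) * Real.exp (-(y ^ 2 / 2)) : ℝ) : ℂ) :=
    funext vacuum_apply
  have hd : deriv vacuum x = -x * vacuum x := by
    rw [hv, h.ofReal_comp.deriv]
    push_cast
    ring
  have : (posOp + Complex.I • momOp) vacuum x = 0 := by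
    simp only [add_apply, smul_apply,
      add_apply, smul_apply, posOp_apply, momOp_apply, hd, smul_eq_mul]
    linear_combination (x * vacuum x) * Complex.I_sq
  rw [annOp, smul_apply, smul_apply, this]
  simp

/-- The canonical commutation relation `[â, â†] = 1`. -/
theorem annOp_creOp (f : 𝓢(ℝ, ℂ)) : annOp (creOp f) = creOp (annOp f) + f := by
  have hc : posOp (momOp f) - momOp (posOp f) = Complex.I • f := by
    ext x
    have h2 := deriv_posOp f x
    rw [sub_apply, posOp_apply, momOp_apply, momOp_apply, h2, smul_apply,
      smul_eq_mul]
    ring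
  have h2 : ((Real.sqrt 2 : ℝ) : ℂ)⁻¹ * ((Real.sqrt 2 : ℝ) : ℂ)⁻¹ = 1 / 2 := by
    rw [← mul_inv, ← Complex.ofReal_mul, Real.mul_self_sqrt (by norm_num)]
    norm_num
  ext x
  have hx := congrArg (fun g : 𝓢(ℝ, ℂ) => g x) hc
  simp only [sub_apply, smul_apply, smul_eq_mul] at hx
  simp only [annOp, creOp, add_apply, sub_apply,
    smul_apply, map_smul, map_add, map_sub, add_apply,
    sub_apply, smul_apply, smul_eq_mul]
  linear_combination (-2 * Complex.I * (posOp (momOp f) x - momOp (posOp f) x)) * h2 -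
    Complex.I * hx - f x * Complex.I_sq

/-- Fock states are the eigenstates of the number operator. -/
theorem numOp_fock (n : ℕ) : numOp (fock n) = (n : ℂ) • fock n := by
  have h : ∀ n : ℕ, numOp ((creOp^[n]) vacuum) = (n : ℂ) • (creOp^[n]) vacuum := by
    intro n
    induction n with
    | zero => simp [numOp, annOp_vacuum]
    | succ n ih =>
      rw [numOp, ContinuousLinearMap.comp_apply] at ih
      rw [Function.iterate_succ_apply', numOp, ContinuousLinearMap.comp_apply, annOp_creOp, ih,
        map_add, map_smul, Nat.cast_succ, add_smul, one_smul]
  rw [fock, map_smul, h, smul_comm]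

/-- Fock wave functions are real. -/
theorem fock_conj (n : ℕ) (x : ℝ) : (starRingEnd ℂ) (fock n x) = fock n x := by
  have hc : ∀ f : 𝓢(ℝ, ℂ), (∀ x, (starRingEnd ℂ) (f x) = f x) →
      ∀ x, (starRingEnd ℂ) (creOp f x) = creOp f x := by
    intro f hf x
    have hd : (starRingEnd ℂ) (deriv f x) = deriv f x := by
      have h1 : HasDerivAt (fun y => (starRingEnd ℂ) (f y)) ((starRingEnd ℂ) (deriv f x)) x :=
        f.differentiableAt.hasDerivAt.star
      simp only [hf] at h1
      exact h1.deriv.symm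
    simp only [creOp, sub_apply, smul_apply,
      sub_apply, smul_apply, posOp_apply, momOp_apply, smul_eq_mul,
      map_mul, map_sub, map_inv₀, map_neg, Complex.conj_ofReal, Complex.conj_I, hf, hd]
    ring
  have h : ∀ n : ℕ, ∀ x, (starRingEnd ℂ) ((creOp^[n]) vacuum x) = (creOp^[n]) vacuum x := by
    intro n
    induction n with
    | zero => intro x; simp only [Function.iterate_zero, id, vacuum_apply, Complex.conj_ofReal]
    | succ n ih =>
      rw [Function.iterate_succ_apply']
      exact hc _ ih
  rw [fock, smul_apply, smul_eq_mul, map_mul, map_inv₀, Complex.conj_ofReal, h]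

/-- The `n`-th term of `e^{-β(n̂+1/2)} T = ∑ₙ e^{-β(n+1/2)} |n⟩⟨n|T⟩`; as the wave function
of `|n⟩` is real, `⟨n|T⟩` is the value of the distribution `T` at it. -/
def dampTerm (β : ℝ) (T : 𝓢'(ℝ, ℂ)) (n : ℕ) : H :=
  (((Real.exp (-β * (n + 1 / 2)) : ℝ) : ℂ) * T (fock n)) • ket (fock n)

/-- `e^{-β(n̂+1/2)}` applied to a generalized ket. -/
def damp (β : ℝ) (T : 𝓢'(ℝ, ℂ)) : H := ∑' n, dampTerm β T n

/-! ### The code states -/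

/-- The spacing `α_d = √(2π/d)` of the square lattice. -/
def spacing (d : ℕ) : ℝ := Real.sqrt (2 * Real.pi / d)

/-- The position `α_d (d s + j)` of the `s`-th peak. -/
def peak (d : ℕ) (j : Fin d) (s : ℤ) : ℝ := spacing d * (d * s + (j : ℕ))

/-- The ideal code state `√(α_d d) ∑ₛ |α_d (d s + j)⟩_q̂`, a Dirac comb. -/
def ideal (d : ℕ) (j : Fin d) : 𝓢'(ℝ, ℂ) :=
  ((Real.sqrt (spacing d * d) : ℝ) : ℂ) • ∑' s : ℤ, TemperedDistribution.delta (peak d j s)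

/-- The terms of Approximation 1:
`e^{-κ² α_d² (d s + j)²/2} X̂(α_d (d s + j)) Ŝ(-ln Δ) |0⟩_f`. -/
def approx1Term (d : ℕ) (j : Fin d) (κ Δ : ℝ) (s : ℤ) : H :=
  ((Real.exp (-(1 / 2) * κ ^ 2 * peak d j s ^ 2) : ℝ) : ℂ) •
    ket (dispX (peak d j s) (squeeze (-Real.log Δ) (fock 0)))

/-- The (unit) state `|j⁽¹⁾_{κ,Δ}⟩` of Approximation 1. -/
def approx1 (d : ℕ) (j : Fin d) (κ Δ : ℝ) : H :=
  NormedSpace.normalize (∑' s, approx1Term d j κ Δ s)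

/-- The integrand of Approximation 2, tested against the Schwartz function `f`:
`(2πγδ)⁻¹ e^{-r₁²/(2γ²) - r₂²/(2δ²)} V̂(r) |j_ideal⟩`. -/
def approx2Integrand (d : ℕ) (j : Fin d) (γ δ : ℝ) (f : 𝓢(ℝ, ℂ)) (r : ℝ × ℝ) : ℂ :=
  ((1 / (2 * Real.pi * γ * δ) *
      Real.exp (-(r.1 ^ 2 / (2 * γ ^ 2)) - r.2 ^ 2 / (2 * δ ^ 2)) : ℝ) : ℂ) *
    dispV r (ideal d j) f

/-- `ψ` is the (weak) integral `∬ dr₁ dr₂/(2πγδ) e^{-r₁²/(2γ²) - r₂²/(2δ²)} V̂(r) |j_ideal⟩`. -/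
def IsApprox2Integral (d : ℕ) (j : Fin d) (γ δ : ℝ) (ψ : H) : Prop :=
  ∀ f : 𝓢(ℝ, ℂ), Lp.toTemperedDistribution ψ f =
    ∫ r : ℝ × ℝ, approx2Integrand d j γ δ f r

open Classical in
/-- The integral of Approximation 2 before normalization (the zero vector if the weak integral
is not in the Hilbert space). -/
def approx2Integral (d : ℕ) (j : Fin d) (γ δ : ℝ) : H :=
  if h : ∃ ψ, IsApprox2Integral d j γ δ ψ then h.choose else 0

/-- The (unit) state `|j⁽²⁾_{γ,δ}⟩` of Approximation 2. -/
def approx2 (d : ℕ) (j : Fin d) (γ δ : ℝ) : H :=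
  NormedSpace.normalize (approx2Integral d j γ δ)

/-- The (unit) state `|j⁽³⁾_β⟩` of Approximation 3, proportional to
`e^{-β(n̂+1/2)} |j_ideal⟩`. -/
def approx3 (d : ℕ) (j : Fin d) (β : ℝ) : H :=
  NormedSpace.normalize (damp β (ideal d j))

/-- `λ(γ,δ) = 1 + γ²δ²/4`. -/
def lam (γ δ : ℝ) : ℝ := 1 + γ ^ 2 * δ ^ 2 / 4

end GKP

end

/-!
All three states are normalizations of one Gaussian comb `∑ₛ e^{-κ² yₛ² / 2} g_σ(x - μ yₛ)`, where
`yₛ` are the peaks of the ideal state and `g_σ` is the Gaussian of width `σ`. Every operator can be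
applied to one peak at a time: squeezing rescales `σ` and `μ` together; averaging displacements of
`|y⟩_q̂` is a Gaussian integral in `r₁` and leaves the wave function with argument `x = y + r₂`;
damping turns `|y⟩_q̂` into Mehler's kernel. Completing the square in each case exhibits a Gaussian
peak, and under the prescriptions all three combs have `κ² = σ² = tanh β` and `μ = 1 / cosh β`.
-/

namespace GKP

open ProbabilityTheory
open scoped Real

/-! ### Hermite sequences -/

section HermiteSeq

/-- The two-parameter Hermite sequence, with exponential generating function
`exp (a z + b z² / 2)`: `b = -1` gives the probabilists' Hermite polynomials at `a`, and `b = 1`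
the sequence with non-negative coefficients that dominates them. -/
def hermiteSeq {R : Type*} [CommRing R] (a b : R) : ℕ → R
  | 0 => 1
  | 1 => a
  | n + 2 => a * hermiteSeq a b (n + 1) + b * (n + 1) * hermiteSeq a b n

theorem hermiteSeq_succ {R : Type*} [CommRing R] (a b : R) (n : ℕ) :
    hermiteSeq a b (n + 1) = a * hermiteSeq a b n + b * n * hermiteSeq a b (n - 1) := by
  cases n <;> simp [hermiteSeq]

theorem hermiteSeq_mul {R : Type*} [CommRing R] (c a b : R) (n : ℕ) :
    hermiteSeq (c * a) (c ^ 2 * b) n = c ^ n * hermiteSeq a b n := by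
  induction n using Nat.twoStepInduction with
  | zero => simp [hermiteSeq]
  | one => simp [hermiteSeq]
  | more n ih₀ ih₁ => rw [hermiteSeq, hermiteSeq, ih₀, ih₁]; ring

theorem map_hermiteSeq {R S : Type*} [CommRing R] [CommRing S] (f : R →+* S) (a b : R) (n : ℕ) :
    f (hermiteSeq a b n) = hermiteSeq (f a) (f b) n := by
  induction n using Nat.twoStepInduction with
  | zero => simp [hermiteSeq]
  | one => simp [hermiteSeq]
  | more n ih₀ ih₁ => simp [hermiteSeq, ih₀, ih₁]

theorem ofReal_hermiteSeq (a b : ℝ) (n : ℕ) :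
    ((hermiteSeq a b n : ℝ) : ℂ) = hermiteSeq (a : ℂ) (b : ℂ) n :=
  map_hermiteSeq Complex.ofRealHom a b n

theorem norm_hermiteSeq_le {R : Type*} [NormedCommRing R] [NormOneClass R] (a b : R) (n : ℕ) :
    ‖hermiteSeq a b n‖ ≤ hermiteSeq ‖a‖ ‖b‖ n := by
  induction n using Nat.twoStepInduction with
  | zero => simp [hermiteSeq]
  | one => simp [hermiteSeq]
  | more n ih₀ ih₁ =>
    have hn : ‖(n + 1 : R)‖ ≤ n + 1 := by simpa using Nat.norm_cast_le (α := R) (n + 1)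
    calc ‖hermiteSeq a b (n + 2)‖
        ≤ ‖a * hermiteSeq a b (n + 1)‖ + ‖b * (n + 1) * hermiteSeq a b n‖ := norm_add_le _ _
      _ ≤ ‖a‖ * ‖hermiteSeq a b (n + 1)‖ + ‖b‖ * ‖(n + 1 : R)‖ * ‖hermiteSeq a b n‖ := by
        grw [norm_mul_le, norm_mul_le, norm_mul_le b]
      _ ≤ hermiteSeq ‖a‖ ‖b‖ (n + 2) := by
        rw [hermiteSeq]; gcongr

theorem hasDerivAt_hermiteSeq {𝕜 : Type*} [NontriviallyNormedField 𝕜] (a b : 𝕜) (n : ℕ) :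
    HasDerivAt (fun a => hermiteSeq a b n) (n * hermiteSeq a b (n - 1)) a := by
  induction n using Nat.twoStepInduction with
  | zero => simpa [hermiteSeq] using hasDerivAt_const a (1 : 𝕜)
  | one => simpa [hermiteSeq] using hasDerivAt_id' a
  | more n ih₀ ih₁ =>
    have h := ((hasDerivAt_id' a).mul ih₁).add (ih₀.const_mul (b * (n + 1)))
    refine h.congr_deriv ?_
    simp only [Nat.add_sub_cancel, Nat.add_succ_sub_one, hermiteSeq_succ a b n]
    push_cast
    ring

theorem iteratedDeriv_exp_quadratic (a b : ℂ) (n : ℕ) :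
    iteratedDeriv n (fun z => Complex.exp (a * z + b * z ^ 2 / 2)) =
      fun z => hermiteSeq (a + b * z) b n * Complex.exp (a * z + b * z ^ 2 / 2) := by
  induction n with
  | zero => simp [hermiteSeq]
  | succ n ih =>
    funext z
    have h_lin : HasDerivAt (fun z => a + b * z) b z := by
      simpa using ((hasDerivAt_id z).const_mul b).const_add a
    have h_quad : HasDerivAt (fun z => a * z + b * z ^ 2 / 2) (a + b * z) z :=
      (((hasDerivAt_id' z).const_mul a).add (((hasDerivAt_pow 2 z).const_mul b).div_const 2)
        ).congr_deriv (by ring)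
    have h_hermite : HasDerivAt (fun z => hermiteSeq (a + b * z) b n)
        (n * hermiteSeq (a + b * z) b (n - 1) * b) z :=
      HasDerivAt.comp (h₂ := fun w => hermiteSeq w b n) z (hasDerivAt_hermiteSeq _ b n) h_lin
    rw [iteratedDeriv_succ, ih, (h_hermite.fun_mul h_quad.cexp).deriv, hermiteSeq_succ]
    ring

theorem hasSum_hermiteSeq (a b z : ℂ) :
    HasSum (fun n : ℕ => hermiteSeq a b n * z ^ n / n.factorial)
      (Complex.exp (a * z + b * z ^ 2 / 2)) := by
  have h_entire : Differentiable ℂ (fun z => Complex.exp (a * z + b * z ^ 2 / 2)) := by fun_prop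
  refine (Complex.hasSum_taylorSeries_of_entire h_entire 0 z).congr_fun fun n => ?_
  simp only [iteratedDeriv_exp_quadratic, smul_eq_mul, mul_zero, add_zero, sub_zero, ne_eq,
    OfNat.ofNat_ne_zero, not_false_eq_true, zero_pow, zero_div, Complex.exp_zero, mul_one]
  ring

theorem hasSum_hermiteSeq_real (a b z : ℝ) :
    HasSum (fun n : ℕ => hermiteSeq a b n * z ^ n / n.factorial)
      (Real.exp (a * z + b * z ^ 2 / 2)) := by
  rw [← Complex.hasSum_ofReal]
  simpa [ofReal_hermiteSeq] using hasSum_hermiteSeq a b z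

end HermiteSeq

/-! ### Mehler's formula -/

section Mehler

theorem integral_cexp_quadratic_real {s : ℝ} (hs : 0 < s) (c d : ℂ) :
    ∫ x : ℝ, Complex.exp (-s * x ^ 2 + c * x + d) =
      (√(π / s) : ℝ) * Complex.exp (d + c ^ 2 / (4 * s)) := by
  rw [integral_cexp_quadratic (by simpa using hs), neg_neg, Real.sqrt_eq_rpow,
    Complex.ofReal_cpow (by positivity)]
  push_cast
  congr 2
  ring

theorem integral_gaussianReal_pow_mul_cexp (z : ℂ) (n : ℕ) :
    ∫ t : ℝ, (t : ℂ) ^ n * Complex.exp (z * t) ∂(gaussianReal 0 1) =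
      hermiteSeq z 1 n * Complex.exp (z ^ 2 / 2) := by
  have h_mgf : complexMGF id (gaussianReal 0 1) =
      fun z => Complex.exp (0 * z + 1 * z ^ 2 / 2) := by
    funext z; simp [complexMGF_id_gaussianReal]
  have h := iteratedDeriv_complexMGF (X := id) (μ := gaussianReal 0 1) (z := z)
    (by simp [integrableExpSet_id_gaussianReal]) n
  rw [h_mgf, iteratedDeriv_exp_quadratic] at h
  simpa using h.symm

theorem integrable_gaussianReal_exp_abs {r : ℝ} (hr : r < 1) (c : ℝ) :
    Integrable (fun t => Real.exp (c * |t| + r * t ^ 2 / 2)) (gaussianReal 0 1) := by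
  have h_exp : ∀ c : ℝ, Integrable fun t : ℝ => Real.exp (-((1 - r) / 2) * t ^ 2 + c * t) :=
    fun c => (integrable_cexp_quadratic (b := ((1 - r) / 2 : ℝ))
      (by simpa using hr) c 0).norm.congr (ae_of_all _ fun t => by
        simp only [Complex.norm_exp]; congr 1; norm_cast; ring)
  rw [gaussianReal_of_var_ne_zero _ one_ne_zero, integrable_withDensity_iff_integrable_smul'
    (measurable_gaussianPDF 0 1) (ae_of_all _ fun _ => gaussianPDF_lt_top)]
  simp only [toReal_gaussianPDF, smul_eq_mul, gaussianPDFReal]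
  refine (((h_exp c).add (h_exp (-c))).const_mul (√(2 * π))⁻¹).mono' (by fun_prop)
    (ae_of_all _ fun t => ?_)
  rw [Real.norm_of_nonneg (by positivity), NNReal.coe_one, mul_one, mul_assoc, ← Real.exp_add,
    Pi.add_apply]
  gcongr
  rcases abs_cases t with ⟨h, -⟩ | ⟨h, -⟩ <;> rw [h]
  · exact le_add_of_le_of_nonneg (Real.exp_le_exp.2 (by linarith)) (by positivity)
  · exact le_add_of_nonneg_of_le (by positivity) (Real.exp_le_exp.2 (by linarith))

section Bilinear

variable (a b ρ : ℝ)

theorem integral_hermite_term (n : ℕ) :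
    ∫ t : ℝ, hermiteSeq (a : ℂ) (-1) n * (-Complex.I * ρ * t) ^ n / n.factorial *
        Complex.exp (Complex.I * b * t) ∂(gaussianReal 0 1) =
      ((ρ ^ n * hermiteSeq a (-1) n * hermiteSeq b (-1) n / n.factorial : ℝ) : ℂ) *
        Complex.exp (-(b ^ 2 / 2)) := by
  have h_split : ∀ t : ℝ, hermiteSeq (a : ℂ) (-1) n * (-Complex.I * ρ * t) ^ n / n.factorial *
      Complex.exp (Complex.I * b * t) = hermiteSeq (a : ℂ) (-1) n * (-Complex.I * ρ) ^ n /
        n.factorial * (t ^ n * Complex.exp (Complex.I * b * t)) := fun t => by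
    rw [mul_pow _ (t : ℂ)]; ring
  have h_rot : hermiteSeq (Complex.I * b) 1 n = Complex.I ^ n * hermiteSeq (b : ℂ) (-1) n := by
    rw [← hermiteSeq_mul]; simp
  have h_unit : (-Complex.I) ^ n * Complex.I ^ n = 1 := by simp [← mul_pow]
  have h_exp : (Complex.I * b) ^ 2 / 2 = -(b ^ 2 / 2 : ℂ) := by
    rw [mul_pow, Complex.I_sq]; ring
  simp only [h_split]
  rw [integral_const_mul, integral_gaussianReal_pow_mul_cexp, h_rot, h_exp, mul_pow]
  push_cast [ofReal_hermiteSeq]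
  linear_combination (ρ ^ n * hermiteSeq (a : ℂ) (-1) n * hermiteSeq (b : ℂ) (-1) n /
    n.factorial * Complex.exp (-(b ^ 2 / 2))) * h_unit

variable {ρ}

theorem integral_hermite_generating (hρ : |ρ| < 1) :
    ∫ t : ℝ, Complex.exp (a * (-Complex.I * ρ * t) + (-1) * (-Complex.I * ρ * t) ^ 2 / 2) *
        Complex.exp (Complex.I * b * t) ∂(gaussianReal 0 1) =
      (((√(1 - ρ ^ 2))⁻¹ * Real.exp ((2 * ρ * a * b - ρ ^ 2 * (a ^ 2 + b ^ 2)) /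
        (2 * (1 - ρ ^ 2))) : ℝ) : ℂ) * Complex.exp (-(b ^ 2 / 2)) := by
  have h_pos : 0 < 1 - ρ ^ 2 := sub_pos.2 ((sq_lt_one_iff_abs_lt_one ρ).2 hρ)
  have h_ne : (1 - (ρ : ℂ) ^ 2) ≠ 0 := by exact_mod_cast h_pos.ne'
  have h_quad : ∀ t : ℝ, gaussianPDFReal 0 1 t • (Complex.exp
      (a * (-Complex.I * ρ * t) + (-1) * (-Complex.I * ρ * t) ^ 2 / 2) *
        Complex.exp (Complex.I * b * t)) = ((√(2 * π))⁻¹ : ℝ) *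
      Complex.exp (-((1 - ρ ^ 2) / 2 : ℝ) * t ^ 2 + (Complex.I * (b - ρ * a)) * t + 0) :=
      fun t => by
    simp only [gaussianPDFReal, NNReal.coe_one, mul_one, sub_zero]
    rw [Complex.real_smul, Complex.ofReal_mul, mul_assoc,
      Complex.ofReal_exp, ← Complex.exp_add, ← Complex.exp_add]
    congr 2
    push_cast
    linear_combination (-ρ ^ 2 * t ^ 2 / 2) * Complex.I_sq
  have h_sqrt : (√(2 * π))⁻¹ * √(π / ((1 - ρ ^ 2) / 2)) = (√(1 - ρ ^ 2))⁻¹ := by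
    rw [show π / ((1 - ρ ^ 2) / 2) = (2 * π) / (1 - ρ ^ 2) by field_simp,
      Real.sqrt_div (by positivity)]
    field_simp
  rw [integral_gaussianReal_eq_integral_smul one_ne_zero]
  simp only [h_quad]
  rw [integral_const_mul, integral_cexp_quadratic_real (by linarith), ← mul_assoc,
    ← Complex.ofReal_mul, h_sqrt, Complex.ofReal_mul, mul_assoc, Complex.ofReal_exp,
    ← Complex.exp_add]
  congr 2
  push_cast
  rw [mul_pow, Complex.I_sq]
  field_simp
  ring

theorem norm_hermite_term_le (n : ℕ) (t : ℝ) :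
    ‖hermiteSeq (a : ℂ) (-1) n * (-Complex.I * ρ * t) ^ n / n.factorial *
        Complex.exp (Complex.I * b * t)‖ ≤ hermiteSeq |a| 1 n * (|ρ| * |t|) ^ n / n.factorial := by
  have h_phase : ‖Complex.exp (Complex.I * b * t)‖ = 1 := by simp [Complex.norm_exp]
  have h_hermite : ‖hermiteSeq (a : ℂ) (-1) n‖ ≤ hermiteSeq |a| 1 n := by
    simpa using norm_hermiteSeq_le (a : ℂ) (-1) n
  simp only [norm_mul, h_phase, norm_div, norm_pow, norm_neg, Complex.norm_I, one_mul, mul_one,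
    Complex.norm_real, Real.norm_eq_abs, Complex.norm_natCast]
  gcongr

-- Writing one Hermite factor as a Gaussian moment turns the left side into the Gaussian integral
-- of the generating function of the other.
theorem hasSum_hermiteSeq_mul_hermiteSeq (hρ : |ρ| < 1) :
    HasSum (fun n : ℕ => ρ ^ n * hermiteSeq a (-1) n * hermiteSeq b (-1) n / n.factorial)
      ((√(1 - ρ ^ 2))⁻¹ *
        Real.exp ((2 * ρ * a * b - ρ ^ 2 * (a ^ 2 + b ^ 2)) / (2 * (1 - ρ ^ 2)))) := by
  have h_dominating : Integrable (fun t => ∑' n : ℕ,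
      hermiteSeq |a| 1 n * (|ρ| * |t|) ^ n / n.factorial) (gaussianReal 0 1) := by
    refine (integrable_gaussianReal_exp_abs ((sq_lt_one_iff_abs_lt_one ρ).2 hρ)
      (|a| * |ρ|)).congr (ae_of_all _ fun t => ?_)
    dsimp only
    rw [(hasSum_hermiteSeq_real |a| 1 (|ρ| * |t|)).tsum_eq, mul_pow, sq_abs, sq_abs, one_mul,
      mul_assoc]
  have h_integrals := hasSum_integral_of_dominated_convergence _
    (fun n => Continuous.aestronglyMeasurable (by fun_prop))
    (fun n => ae_of_all _ (norm_hermite_term_le a b n))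
    (ae_of_all _ fun t => (hasSum_hermiteSeq_real |a| 1 (|ρ| * |t|)).summable) h_dominating
    (ae_of_all _ fun t => (hasSum_hermiteSeq a (-1) (-Complex.I * ρ * t)).mul_right _)
  simp only [integral_hermite_term, integral_hermite_generating a b hρ] at h_integrals
  exact Complex.hasSum_ofReal.1 ((hasSum_mul_right_iff (Complex.exp_ne_zero _)).1 h_integrals)

end Bilinear

end Mehler

/-! ### Fock wave functions -/

section Fock

theorem annOp_add_creOp (f : 𝓢(ℝ, ℂ)) (x : ℝ) :
    annOp f x + creOp f x = ((√2 : ℝ) : ℂ) * x * f x := by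
  have h_sq : ((√2 : ℝ) : ℂ) * ((√2 : ℝ) : ℂ) = 2 := by
    rw [← Complex.ofReal_mul, Real.mul_self_sqrt (by norm_num)]; norm_num
  have h_ne : ((√2 : ℝ) : ℂ) ≠ 0 := by simp
  simp only [annOp, creOp, add_apply, sub_apply, smul_apply, smul_eq_mul, posOp_apply]
  field_simp
  linear_combination (-x * f x) * h_sq

theorem annOp_creOp_iterate (n : ℕ) :
    annOp (creOp^[n + 1] vacuum) = ((n : ℂ) + 1) • creOp^[n] vacuum := by
  induction n with
  | zero => simp [annOp_creOp, annOp_vacuum]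
  | succ n ih =>
    rw [Function.iterate_succ_apply', annOp_creOp, ih, map_smul,
      ← Function.iterate_succ_apply' creOp, Nat.cast_succ, add_smul (_ + 1) (1 : ℂ), one_smul]

theorem creOp_iterate_apply (n : ℕ) (x : ℝ) :
    (creOp^[n] vacuum) x = ((hermiteSeq (√2 * x) (-1) n : ℝ) : ℂ) * vacuum x := by
  induction n using Nat.twoStepInduction with
  | zero => simp [hermiteSeq]
  | one => simpa [annOp_vacuum, hermiteSeq] using annOp_add_creOp vacuum x
  | more n ih₀ ih₁ =>
    have h := annOp_add_creOp (creOp^[n + 1] vacuum) x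
    rw [annOp_creOp_iterate, ← Function.iterate_succ_apply' creOp, smul_apply, smul_eq_mul, ih₀,
      ih₁] at h
    rw [hermiteSeq]
    push_cast
    linear_combination h

/-- The wave function of the Fock state `|n⟩_f`, as a real-valued function. -/
noncomputable def fockReal (n : ℕ) (x : ℝ) : ℝ :=
  hermiteSeq (√2 * x) (-1) n / √n.factorial * (π ^ (-(1 / 4) : ℝ) * Real.exp (-(x ^ 2 / 2)))

theorem fock_apply (n : ℕ) (x : ℝ) : fock n x = (fockReal n x : ℂ) := by
  rw [fock, smul_apply, smul_eq_mul, creOp_iterate_apply, vacuum_apply, fockReal]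
  push_cast
  ring

theorem fockReal_mul_fockReal (n : ℕ) (x y : ℝ) :
    fockReal n x * fockReal n y = (√π)⁻¹ * Real.exp (-((x ^ 2 + y ^ 2) / 2)) *
      (hermiteSeq (√2 * x) (-1) n * hermiteSeq (√2 * y) (-1) n / n.factorial) := by
  have h_pi : π ^ (-(1 / 4) : ℝ) * π ^ (-(1 / 4) : ℝ) = (√π)⁻¹ := by
    rw [← Real.rpow_add Real.pi_pos, Real.sqrt_eq_rpow, ← Real.rpow_neg Real.pi_pos.le]
    norm_num
  have h_factorial : √(n.factorial : ℝ) * √(n.factorial : ℝ) = n.factorial :=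
    Real.mul_self_sqrt (by positivity)
  rw [← h_pi, ← h_factorial, add_div, neg_add, Real.exp_add, fockReal, fockReal]
  ring

/-- Mehler's kernel, the position-space kernel of `e^{-β(n̂+1/2)}`. -/
noncomputable def mehlerKernel (β x y : ℝ) : ℝ :=
  (√(2 * π * Real.sinh β))⁻¹ *
    Real.exp (-(Real.cosh β * (x ^ 2 + y ^ 2) - 2 * x * y) / (2 * Real.sinh β))

theorem mehlerKernel_eq {β : ℝ} (hβ : 0 < β) (x y : ℝ) :
    mehlerKernel β x y = Real.exp (-β / 2) * ((√π)⁻¹ * Real.exp (-((x ^ 2 + y ^ 2) / 2))) *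
      ((√(1 - Real.exp (-β) ^ 2))⁻¹ * Real.exp ((2 * Real.exp (-β) * (√2 * x) * (√2 * y) -
        Real.exp (-β) ^ 2 * ((√2 * x) ^ 2 + (√2 * y) ^ 2)) / (2 * (1 - Real.exp (-β) ^ 2)))) := by
  have : 0 < Real.sinh β := Real.sinh_pos_iff.2 hβ
  have h_two : √2 ^ 2 = 2 := Real.sq_sqrt (by norm_num)
  have h_half : Real.exp (-β / 2) ^ 2 = Real.exp (-β) := by
    rw [← Real.exp_nat_mul]; ring_nf
  have h_one_sub : 1 - Real.exp (-β) ^ 2 = 2 * Real.exp (-β) * Real.sinh β := by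
    have : Real.exp (-β) * Real.exp β = 1 := by rw [← Real.exp_add]; simp
    rw [Real.sinh_eq]
    linear_combination -this
  have h_const : Real.exp (-β / 2) * (√π)⁻¹ * (√(1 - Real.exp (-β) ^ 2))⁻¹ =
      (√(2 * π * Real.sinh β))⁻¹ := by
    rw [h_one_sub, show 2 * Real.exp (-β) * Real.sinh β =
        Real.exp (-β / 2) ^ 2 * (2 * Real.sinh β) by rw [h_half]; ring,
      Real.sqrt_mul (by positivity), Real.sqrt_sq (Real.exp_pos _).le,
      show 2 * π * Real.sinh β = π * (2 * Real.sinh β) by ring, Real.sqrt_mul Real.pi_pos.le]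
    field_simp
  have h_cosh : Real.cosh β = Real.sinh β + Real.exp (-β) := by
    rw [← Real.cosh_sub_sinh]; ring
  rw [mehlerKernel, ← h_const, ← mul_assoc (Real.exp (-β / 2)), mul_mul_mul_comm, ← Real.exp_add,
    h_one_sub, h_cosh]
  congr 2
  simp only [mul_pow, h_two]
  rw [show 2 * Real.exp (-β) * (√2 * x) * (√2 * y) = 2 * Real.exp (-β) * x * y * √2 ^ 2 by ring,
    h_two]
  field_simp
  ring

theorem hasSum_mehlerKernel {β : ℝ} (hβ : 0 < β) (x y : ℝ) :
    HasSum (fun n : ℕ => Real.exp (-β * (n + 1 / 2)) * fockReal n x * fockReal n y)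
      (mehlerKernel β x y) := by
  have h_lt : |Real.exp (-β)| < 1 := by simpa using hβ
  have h_exp (n : ℕ) :
      Real.exp (-β * (n + 1 / 2)) = Real.exp (-β / 2) * Real.exp (-β) ^ n := by
    rw [← Real.exp_nat_mul, ← Real.exp_add]; ring_nf
  rw [mehlerKernel_eq hβ]
  refine ((hasSum_hermiteSeq_mul_hermiteSeq (√2 * x) (√2 * y) h_lt).mul_left _).congr_fun
    fun n => ?_
  rw [mul_assoc, fockReal_mul_fockReal, h_exp]
  ring

theorem mehlerKernel_two_mul_self {β : ℝ} (hβ : β ≠ 0) (x : ℝ) :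
    mehlerKernel (2 * β) x x =
      (√(2 * π * Real.sinh (2 * β)))⁻¹ * Real.exp (-Real.tanh β * x ^ 2) := by
  have h_sinh : Real.sinh β ≠ 0 := by simpa using hβ
  have := Real.cosh_pos β
  rw [mehlerKernel, Real.sinh_two_mul, Real.cosh_two_mul, Real.cosh_sq,
    Real.tanh_eq_sinh_div_cosh]
  congr 2
  field_simp
  ring

theorem tanh_pos {β : ℝ} (hβ : 0 < β) : 0 < Real.tanh β := by
  rw [Real.tanh_eq_sinh_div_cosh]
  exact div_pos (Real.sinh_pos_iff.2 hβ) (Real.cosh_pos β)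

-- All terms of the diagonal Mehler series are non-negative, so each one is at most its sum.
theorem exists_abs_fockReal_le {ε : ℝ} (hε : 0 < ε) : ∃ B τ : ℝ, 0 < B ∧ 0 < τ ∧ ∀ n x,
    |fockReal n x| ≤ B * Real.exp (ε * n) * Real.exp (-τ * x ^ 2) := by
  have : 0 < Real.sinh (2 * ε) := Real.sinh_pos_iff.2 (by linarith)
  set C := (√(2 * π * Real.sinh (2 * ε)))⁻¹
  refine ⟨√(Real.exp ε * C), Real.tanh ε / 2, by positivity, half_pos (tanh_pos hε), fun n x => ?_⟩
  refine abs_le_of_sq_le_sq ?_ (by positivity)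
  have h_term : Real.exp (-(2 * ε) * (n + 1 / 2)) * fockReal n x * fockReal n x ≤
      C * Real.exp (-Real.tanh ε * x ^ 2) := by
    have h := le_hasSum (hasSum_mehlerKernel (β := 2 * ε) (by linarith) x x) n fun m _ => by
      rw [mul_assoc]; exact mul_nonneg (Real.exp_pos _).le (mul_self_nonneg _)
    rwa [mehlerKernel_two_mul_self hε.ne'] at h
  calc fockReal n x ^ 2
      = Real.exp (ε + 2 * (ε * n)) *
          (Real.exp (-(2 * ε) * (n + 1 / 2)) * fockReal n x * fockReal n x) := by
        rw [← mul_assoc, ← mul_assoc, ← Real.exp_add]; ring_nf; simp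
    _ ≤ Real.exp (ε + 2 * (ε * n)) * (C * Real.exp (-Real.tanh ε * x ^ 2)) := by gcongr
    _ = (√(Real.exp ε * C) * Real.exp (ε * n) * Real.exp (-(Real.tanh ε / 2) * x ^ 2)) ^ 2 := by
        rw [mul_pow, mul_pow, Real.sq_sqrt (by positivity), ← Real.exp_nat_mul,
          ← Real.exp_nat_mul, Real.exp_add]
        push_cast
        ring_nf

theorem memLp_exp_neg_mul_sq {τ : ℝ} (hτ : 0 < τ) :
    MemLp (fun x : ℝ => Real.exp (-τ * x ^ 2)) 2 volume := by
  rw [memLp_two_iff_integrable_sq (by fun_prop)]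
  refine (integrable_exp_neg_mul_sq (b := 2 * τ) (by linarith)).congr (ae_of_all _ fun x => ?_)
  dsimp only
  rw [← Real.exp_nat_mul]
  push_cast
  ring_nf

theorem exists_norm_ket_fock_le {ε : ℝ} (hε : 0 < ε) : ∃ B : ℝ, 0 ≤ B ∧ ∀ n,
    ‖ket (fock n)‖ ≤ B * Real.exp (ε * n) := by
  obtain ⟨B, τ, hB, hτ, h_fock⟩ := exists_abs_fockReal_le hε
  set G := (memLp_exp_neg_mul_sq hτ).toLp
  refine ⟨B * ‖G‖, by positivity, fun n => ?_⟩
  have h_le : ‖ket (fock n)‖ ≤ B * Real.exp (ε * n) * ‖G‖ := by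
    refine Lp.norm_le_mul_norm_of_ae_le_mul ?_
    filter_upwards [SchwartzMap.coeFn_toLp (fock n) 2 volume,
      (memLp_exp_neg_mul_sq hτ).coeFn_toLp] with x hx hG
    rw [ket, hx, hG, fock_apply, Complex.norm_real, Real.norm_eq_abs, Real.norm_eq_abs,
      Real.abs_exp]
    exact h_fock n x
  exact h_le.trans_eq (by ring)

end Fock

/-! ### Vectors of the Hilbert space -/

section HilbertSpace

theorem ket_smul (c : ℂ) (f : 𝓢(ℝ, ℂ)) : ket (c • f) = c • ket f :=
  map_smul (SchwartzMap.toLpCLM ℂ ℂ 2 (volume : Measure ℝ)) c f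

theorem norm_ket_dispX (r : ℝ) (f : 𝓢(ℝ, ℂ)) : ‖ket (dispX r f)‖ = ‖ket f‖ := by
  have h_comp : (dispX r f : ℝ → ℂ) = f ∘ fun x => x - r := funext (dispX_apply r f)
  have h_norm := eLpNorm_comp_measurePreserving (p := 2) f.continuous.aestronglyMeasurable
    (measurePreserving_sub_right (volume : Measure ℝ) r)
  rw [ket, ket, SchwartzMap.toLp, SchwartzMap.toLp, Lp.norm_toLp, Lp.norm_toLp, h_comp, h_norm]

theorem toTemperedDistribution_ket (f g : 𝓢(ℝ, ℂ)) :
    Lp.toTemperedDistribution (ket f) g = ∫ x, g x * f x := by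
  rw [Lp.toTemperedDistribution_apply]
  refine integral_congr_ae ?_
  filter_upwards [SchwartzMap.coeFn_toLp f 2 volume] with x hx
  rw [ket, hx, smul_eq_mul]

theorem hasSum_toTemperedDistribution {ι : Type*} {u : ι → H} {v : H} (h : HasSum u v)
    (f : 𝓢(ℝ, ℂ)) :
    HasSum (fun i => Lp.toTemperedDistribution (u i) f) (Lp.toTemperedDistribution v f) :=
  (h.mapL (Lp.toTemperedDistributionCLM ℂ volume 2)).mapL
    (PointwiseConvergenceCLM.evalCLM (RingHom.id ℂ) ℂ f)

theorem toTemperedDistribution_injective {u v : H}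
    (h : ∀ f : 𝓢(ℝ, ℂ), Lp.toTemperedDistribution u f = Lp.toTemperedDistribution v f) :
    u = v := by
  have h_ker := Lp.ker_toTemperedDistributionCLM_eq_bot (F := ℂ) (μ := (volume : Measure ℝ))
    (p := 2)
  refine LinearMap.ker_eq_bot.1 h_ker ?_
  ext f
  exact h f

theorem ae_hasSum_ket_apply {ι : Type*} [Countable ι] {f : ι → 𝓢(ℝ, ℂ)}
    (hf : Summable fun i => ‖ket (f i)‖) :
    ∀ᵐ x, HasSum (fun i => f i x) ((∑' i, ket (f i) : H) x) := by
  filter_upwards [Lp.hasSum_coeFn_tsum (tsum_enorm_ne_top_iff_summable_norm.2 hf),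
    ae_all_iff.2 fun i => SchwartzMap.coeFn_toLp (f i) 2 volume] with x h_sum h_ket
  simpa only [ket, h_ket] using h_sum

theorem hasSum_ket {ι : Type*} [Countable ι] {f : ι → 𝓢(ℝ, ℂ)} {g : 𝓢(ℝ, ℂ)}
    (hf : Summable fun i => ‖ket (f i)‖) (hg : ∀ x, HasSum (fun i => f i x) (g x)) :
    HasSum (fun i => ket (f i)) (ket g) := by
  have h_eq : (∑' i, ket (f i) : H) = ket g := by
    refine Lp.ext ?_
    filter_upwards [ae_hasSum_ket_apply hf, SchwartzMap.coeFn_toLp g 2 volume] with x h_sum h_ket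
    rw [h_sum.unique (hg x), ket, h_ket]
  exact h_eq ▸ hf.of_norm.hasSum

theorem normalize_ofReal_smul {c : ℝ} (hc : 0 < c) (ψ : H) :
    NormedSpace.normalize ((c : ℂ) • ψ) = NormedSpace.normalize ψ :=
  NormedSpace.normalize_smul_of_pos hc ψ

end HilbertSpace

/-! ### Squeezing -/

section Squeezing

theorem squeeze_squeeze (ξ η : ℝ) (f : 𝓢(ℝ, ℂ)) :
    squeeze ξ (squeeze η f) = squeeze (ξ + η) f := by
  ext x
  simp only [squeeze_apply, add_div, Real.exp_add, Complex.ofReal_mul]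
  ring_nf

theorem squeeze_dispX (ξ r : ℝ) (f : 𝓢(ℝ, ℂ)) :
    squeeze ξ (dispX r f) = dispX (Real.exp (-ξ) * r) (squeeze ξ f) := by
  ext x
  have h_exp : Real.exp ξ * Real.exp (-ξ) = 1 := by rw [← Real.exp_add]; simp
  simp only [squeeze_apply, dispX_apply, mul_sub, ← mul_assoc, h_exp, one_mul]

theorem coeFn_squeezeH (ξ : ℝ) (ψ : H) : squeezeH ξ ψ =ᵐ[volume]
    fun x : ℝ => ((Real.exp (ξ / 2) : ℝ) : ℂ) * ψ (Real.exp ξ * x) :=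
  (memLp_squeeze ξ ψ).coeFn_toLp

theorem quasiMeasurePreserving_mul_left {a : ℝ} (ha : a ≠ 0) :
    Measure.QuasiMeasurePreserving (fun x : ℝ => a * x) volume volume :=
  ⟨by fun_prop, by
    rw [Real.map_volume_mul_left ha]
    exact Measure.smul_absolutelyContinuous⟩

/-- The squeezing operator `Ŝ(ξ)` as a linear isometry, so that it can be applied termwise to a
convergent series. -/
noncomputable def squeezeIsometry (ξ : ℝ) : H →ₗᵢ[ℂ] H where
  toFun := squeezeH ξ
  map_add' φ ψ := by
    refine Lp.ext ?_
    filter_upwards [coeFn_squeezeH ξ (φ + ψ), Lp.coeFn_add (squeezeH ξ φ) (squeezeH ξ ψ),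
      coeFn_squeezeH ξ φ, coeFn_squeezeH ξ ψ,
      (quasiMeasurePreserving_mul_left (Real.exp_ne_zero ξ)).ae_eq_comp (Lp.coeFn_add φ ψ)]
      with x h_add h_sum hφ hψ h_comp
    simp only [Function.comp_apply, Pi.add_apply] at h_sum h_comp
    rw [h_add, h_sum, hφ, hψ, h_comp, mul_add]
  map_smul' c ψ := by
    refine Lp.ext ?_
    filter_upwards [coeFn_squeezeH ξ (c • ψ), Lp.coeFn_smul c (squeezeH ξ ψ), coeFn_squeezeH ξ ψ,
      (quasiMeasurePreserving_mul_left (Real.exp_ne_zero ξ)).ae_eq_comp (Lp.coeFn_smul c ψ)]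
      with x h_smul h_mul hψ h_comp
    simp only [Function.comp_apply, Pi.smul_apply, smul_eq_mul] at h_mul h_comp
    rw [h_smul, RingHom.id_apply, h_mul, hψ, h_comp]
    ring
  norm_map' := norm_squeezeH ξ

theorem hasSum_squeezeH {ι : Type*} {u : ι → H} {v : H} (h : HasSum u v) (ξ : ℝ) :
    HasSum (fun i => squeezeH ξ (u i)) (squeezeH ξ v) :=
  h.mapL (squeezeIsometry ξ).toContinuousLinearMap

theorem squeezeH_normalize (ξ : ℝ) (ψ : H) :
    squeezeH ξ (NormedSpace.normalize ψ) = NormedSpace.normalize (squeezeH ξ ψ) := by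
  rw [NormedSpace.normalize, NormedSpace.normalize, norm_squeezeH]
  exact LinearMap.map_smul_of_tower (squeezeIsometry ξ).toLinearMap ‖ψ‖⁻¹ ψ

end Squeezing

/-! ### Dirac combs -/

section DiracComb

theorem summable_inv_one_add_abs_affine_sq {a : ℝ} (ha : a ≠ 0) (b : ℝ) :
    Summable fun s : ℤ => ((1 + |a * s + b|) ^ 2)⁻¹ := by
  refine Summable.of_norm_bounded_eventually
    (((Real.summable_one_div_int_add_rpow (b / a) 2).2 one_lt_two).mul_left (|a| ^ 2)⁻¹) ?_
  have h_finite : {s : ℤ | (s : ℝ) + b / a = 0}.Finite :=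
    Set.Subsingleton.finite fun s hs t ht => by
      rw [Set.mem_ofPred_eq] at hs ht
      exact_mod_cast add_right_cancel (hs.trans ht.symm)
  filter_upwards [h_finite.compl_mem_cofinite] with s hs
  have h_pos : 0 < |(s : ℝ) + b / a| := abs_pos.2 hs
  have h_abs : |a * s + b| = |a| * |(s : ℝ) + b / a| := by
    rw [← abs_mul, mul_add, mul_div_cancel₀ b ha]
  rw [Real.norm_of_nonneg (by positivity), Real.rpow_two, one_div, ← mul_inv, ← mul_pow, h_abs]
  gcongr
  linarith

theorem one_add_abs_sq_le {τ : ℝ} (hτ : 0 < τ) (y : ℝ) :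
    (1 + |y|) ^ 2 ≤ 2 * (1 + τ⁻¹) * Real.exp (τ * y ^ 2) := by
  have h_sq : (1 + |y|) ^ 2 ≤ 2 * (1 + y ^ 2) := by
    nlinarith [sq_nonneg (1 - |y|), sq_abs y]
  have h_mul : (1 + τ⁻¹) * (1 + τ * y ^ 2) = 1 + y ^ 2 + (τ⁻¹ + τ * y ^ 2) := by
    field_simp
    ring
  have h_nonneg : 0 ≤ τ⁻¹ + τ * y ^ 2 := by positivity
  have h_exp : (1 + τ⁻¹) * (1 + τ * y ^ 2) ≤ (1 + τ⁻¹) * Real.exp (τ * y ^ 2) :=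
    mul_le_mul_of_nonneg_left (by linarith [Real.add_one_le_exp (τ * y ^ 2)]) (by positivity)
  linarith

theorem norm_le_seminorm_mul_inv (f : 𝓢(ℝ, ℂ)) (x : ℝ) :
    ‖f x‖ ≤ 2 ^ 2 * (Finset.Iic (2, 0)).sup (schwartzSeminormFamily ℂ ℝ ℂ) f *
      ((1 + |x|) ^ 2)⁻¹ := by
  have h := SchwartzMap.one_add_le_sup_seminorm_apply (𝕜 := ℂ) (m := (2, 0)) (k := 2) (n := 0)
    le_rfl le_rfl f x
  rw [norm_iteratedFDeriv_zero] at h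
  rw [← div_eq_mul_inv, le_div_iff₀ (by positivity), mul_comm]
  exact h

theorem exists_norm_le_mul_inv (f : 𝓢(ℝ, ℂ)) :
    ∃ C : ℝ, 0 ≤ C ∧ ∀ x, ‖f x‖ ≤ C * ((1 + |x|) ^ 2)⁻¹ :=
  ⟨_, by positivity, norm_le_seminorm_mul_inv f⟩

variable {ι : Type*} {y : ι → ℝ}

theorem summable_exp_neg_mul_sq (hy : Summable fun i => ((1 + |y i|) ^ 2)⁻¹) {τ : ℝ}
    (hτ : 0 < τ) : Summable fun i => Real.exp (-τ * y i ^ 2) := by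
  refine Summable.of_nonneg_of_le (fun i => (Real.exp_pos _).le) (fun i => ?_)
    (hy.mul_left (2 * (1 + τ⁻¹)))
  rw [← div_eq_mul_inv, le_div_iff₀ (by positivity), neg_mul, Real.exp_neg, inv_mul_le_iff₀
    (Real.exp_pos _), mul_comm]
  exact one_add_abs_sq_le hτ _

theorem summable_schwartz_apply (hy : Summable fun i => ((1 + |y i|) ^ 2)⁻¹) (f : 𝓢(ℝ, ℂ)) :
    Summable fun i => f (y i) :=
  Summable.of_norm_bounded (hy.mul_left _) fun _ => norm_le_seminorm_mul_inv f _

/-- The Dirac comb `∑ᵢ |yᵢ⟩_q̂` on a family of points whose density is bounded polynomially, as a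
tempered distribution. -/
noncomputable def diracComb (hy : Summable fun i => ((1 + |y i|) ^ 2)⁻¹) : 𝓢'(ℝ, ℂ) :=
  ContinuousLinearMap.toPointwiseConvergenceCLM _ _ _ _ <|
    SchwartzMap.mkCLMtoNormedSpace (𝕜 := ℂ) (σ := RingHom.id ℂ)
      (fun f : 𝓢(ℝ, ℂ) => ∑' i, f (y i))
      (fun f g => by
        simpa using (summable_schwartz_apply hy f).tsum_add (summable_schwartz_apply hy g))
      (fun a f => by simp [tsum_mul_left])
      ⟨Finset.Iic (2, 0), 2 ^ 2 * ∑' i, ((1 + |y i|) ^ 2)⁻¹,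
        mul_nonneg (by norm_num) (tsum_nonneg fun i => by positivity), fun f => by
        have h_le := tsum_of_norm_bounded (hy.mul_left (2 ^ 2 *
          (Finset.Iic (2, 0)).sup (schwartzSeminormFamily ℂ ℝ ℂ) f)).hasSum
            fun _ => norm_le_seminorm_mul_inv f _
        rw [tsum_mul_left] at h_le
        linarith⟩

theorem hasSum_diracComb_apply (hy : Summable fun i => ((1 + |y i|) ^ 2)⁻¹) (f : 𝓢(ℝ, ℂ)) :
    HasSum (fun i => f (y i)) (diracComb hy f) :=
  (summable_schwartz_apply hy f).hasSum

theorem hasSum_delta (hy : Summable fun i => ((1 + |y i|) ^ 2)⁻¹) :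
    HasSum (fun i => (TemperedDistribution.delta (y i) : 𝓢'(ℝ, ℂ))) (diracComb hy) := by
  rw [HasSum, PointwiseConvergenceCLM.tendsto_iff_forall_tendsto]
  intro f
  have h := hasSum_diracComb_apply hy f
  rw [HasSum] at h
  refine h.congr fun S => ?_
  simp

theorem spacing_pos {d : ℕ} (j : Fin d) : 0 < spacing d := by
  have : (0 : ℝ) < d := by exact_mod_cast j.pos
  rw [spacing]
  positivity

theorem spacing_mul_pos {d : ℕ} (j : Fin d) : 0 < spacing d * d :=
  mul_pos (spacing_pos j) (by exact_mod_cast j.pos)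

theorem summable_inv_one_add_abs_peak_sq {d : ℕ} (j : Fin d) :
    Summable fun s : ℤ => ((1 + |peak d j s|) ^ 2)⁻¹ := by
  simpa only [peak, mul_add, ← mul_assoc] using
    summable_inv_one_add_abs_affine_sq (spacing_mul_pos j).ne' (spacing d * (j : ℕ))

theorem ideal_eq_smul_diracComb {d : ℕ} (j : Fin d) :
    ideal d j = ((√(spacing d * d) : ℝ) : ℂ) • diracComb (summable_inv_one_add_abs_peak_sq j) := by
  rw [ideal, (hasSum_delta (summable_inv_one_add_abs_peak_sq j)).tsum_eq]

end DiracComb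

/-! ### Gaussian combs -/

section GaussianComb

/-- The Gaussian wave packet `e^{-κ²y²/2} X̂(μ y) Ŝ(-ln σ) |0⟩_f`: width `σ`, centre `μ y`, and an
envelope of width `1/κ` in the position `y` of the original peak. -/
noncomputable def gaussianPeak (κ σ μ y : ℝ) : 𝓢(ℝ, ℂ) :=
  ((Real.exp (-(1 / 2) * κ ^ 2 * y ^ 2) : ℝ) : ℂ) •
    dispX (μ * y) (squeeze (-Real.log σ) vacuum)

/-- The maximum of the `L²`-normalized Gaussian wave function of width `σ`. -/
noncomputable def peakHeight (σ : ℝ) : ℝ := (√σ)⁻¹ * π ^ (-(1 / 4) : ℝ)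

theorem peakHeight_pos {σ : ℝ} (hσ : 0 < σ) : 0 < peakHeight σ := by
  unfold peakHeight
  positivity

theorem gaussianPeak_apply (κ : ℝ) {σ : ℝ} (hσ : 0 < σ) (μ y x : ℝ) :
    gaussianPeak κ σ μ y x = ((peakHeight σ *
      Real.exp (-(κ ^ 2 * y ^ 2 / 2 + (x - μ * y) ^ 2 / (2 * σ ^ 2))) : ℝ) : ℂ) := by
  have h_scale : Real.exp (-Real.log σ) = σ⁻¹ := by rw [Real.exp_neg, Real.exp_log hσ]
  rw [gaussianPeak, smul_apply, dispX_apply, squeeze_apply, vacuum_apply, Real.exp_half, h_scale,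
    Real.sqrt_inv, peakHeight, smul_eq_mul, neg_add, Real.exp_add]
  push_cast
  ring_nf

theorem squeeze_gaussianPeak (κ : ℝ) {σ c : ℝ} (hσ : 0 < σ) (hc : 0 < c) (μ y : ℝ) :
    squeeze (Real.log c) (gaussianPeak κ σ μ y) = gaussianPeak κ (σ / c) (μ / c) y := by
  rw [gaussianPeak, map_smul, squeeze_dispX, squeeze_squeeze, Real.exp_neg, Real.exp_log hc,
    gaussianPeak, Real.log_div hσ.ne' hc.ne', neg_sub, ← sub_eq_add_neg, div_mul_eq_mul_div,
    ← div_eq_inv_mul]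

variable {ι : Type*} {y : ι → ℝ}

theorem summable_norm_ket_gaussianPeak (hy : Summable fun i => ((1 + |y i|) ^ 2)⁻¹) {κ : ℝ}
    (hκ : κ ≠ 0) (σ μ : ℝ) : Summable fun i => ‖ket (gaussianPeak κ σ μ (y i))‖ := by
  have h_norm : ∀ i, ‖ket (gaussianPeak κ σ μ (y i))‖ =
      Real.exp (-(κ ^ 2 / 2) * y i ^ 2) * ‖ket (squeeze (-Real.log σ) vacuum)‖ := fun i => by
    rw [gaussianPeak, ket_smul, norm_smul, norm_ket_dispX, Complex.norm_real, Real.norm_eq_abs,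
      Real.abs_exp]
    ring_nf
  simpa only [h_norm] using
    (summable_exp_neg_mul_sq hy (τ := κ ^ 2 / 2) (by positivity)).mul_right _

/-- The superposition `∑ᵢ e^{-κ²yᵢ²/2} X̂(μ yᵢ) Ŝ(-ln σ) |0⟩_f` of Gaussian peaks. -/
noncomputable def gaussianComb (y : ι → ℝ) (κ σ μ : ℝ) : H :=
  ∑' i, ket (gaussianPeak κ σ μ (y i))

theorem hasSum_gaussianComb (hy : Summable fun i => ((1 + |y i|) ^ 2)⁻¹) {κ : ℝ}
    (hκ : κ ≠ 0) (σ μ : ℝ) :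
    HasSum (fun i => ket (gaussianPeak κ σ μ (y i))) (gaussianComb y κ σ μ) :=
  (summable_norm_ket_gaussianPeak hy hκ σ μ).of_norm.hasSum

theorem gaussianComb_ne_zero [Countable ι] [Nonempty ι]
    (hy : Summable fun i => ((1 + |y i|) ^ 2)⁻¹) {κ σ : ℝ} (hκ : κ ≠ 0) (hσ : 0 < σ) (μ : ℝ) :
    gaussianComb y κ σ μ ≠ 0 := by
  intro h_zero
  obtain ⟨x, h_sum, hx⟩ := ((ae_hasSum_ket_apply (summable_norm_ket_gaussianPeak hy hκ σ μ)).and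
    (Lp.coeFn_zero ℂ 2 (volume : Measure ℝ))).exists
  rw [← gaussianComb, h_zero, hx, Pi.zero_apply, ← Complex.ofReal_zero] at h_sum
  simp only [gaussianPeak_apply κ hσ] at h_sum
  rw [Complex.hasSum_ofReal] at h_sum
  have h_pos : ∀ i, 0 < peakHeight σ *
      Real.exp (-(κ ^ 2 * y i ^ 2 / 2 + (x - μ * y i) ^ 2 / (2 * σ ^ 2))) :=
    fun i => mul_pos (peakHeight_pos hσ) (Real.exp_pos _)
  rw [hasSum_zero_iff_of_nonneg fun i => (h_pos i).le] at h_sum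
  obtain ⟨i⟩ := ‹Nonempty ι›
  exact (h_pos i).ne' (congrFun h_sum i)

theorem squeezeH_gaussianComb (hy : Summable fun i => ((1 + |y i|) ^ 2)⁻¹) {κ σ c : ℝ}
    (hκ : κ ≠ 0) (hσ : 0 < σ) (hc : 0 < c) (μ : ℝ) :
    squeezeH (Real.log c) (gaussianComb y κ σ μ) = gaussianComb y κ (σ / c) (μ / c) := by
  have h := hasSum_squeezeH (hasSum_gaussianComb hy hκ σ μ) (Real.log c)
  simp only [squeezeH_ket, squeeze_gaussianPeak κ hσ hc] at h
  exact h.unique (hasSum_gaussianComb hy hκ (σ / c) (μ / c))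

end GaussianComb

/-! ### Approximation 1 -/

section Approximation1

theorem approx1Term_eq_ket {d : ℕ} (j : Fin d) (κ Δ : ℝ) :
    approx1Term d j κ Δ = fun s => ket (gaussianPeak κ Δ 1 (peak d j s)) := by
  ext1 s
  simp [approx1Term, gaussianPeak, ket_smul, fock]

theorem summable_approx1Term {d : ℕ} (j : Fin d) {κ : ℝ} (hκ : κ ≠ 0) (Δ : ℝ) :
    Summable (approx1Term d j κ Δ) := by
  rw [approx1Term_eq_ket]
  exact (hasSum_gaussianComb (summable_inv_one_add_abs_peak_sq j) hκ Δ 1).summable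

theorem approx1_eq_normalize {d : ℕ} (j : Fin d) (κ Δ : ℝ) :
    approx1 d j κ Δ = NormedSpace.normalize (gaussianComb (peak d j) κ Δ 1) := by
  rw [approx1, approx1Term_eq_ket, gaussianComb]

theorem squeezeH_approx1 {d : ℕ} (j : Fin d) {κ Δ c : ℝ} (hκ : κ ≠ 0) (hΔ : 0 < Δ) (hc : 0 < c) :
    squeezeH (Real.log c) (approx1 d j κ Δ) =
      NormedSpace.normalize (gaussianComb (peak d j) κ (Δ / c) (1 / c)) := by
  rw [approx1_eq_normalize, squeezeH_normalize,
    squeezeH_gaussianComb (summable_inv_one_add_abs_peak_sq j) hκ hΔ hc]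

theorem norm_approx1 {d : ℕ} (j : Fin d) {κ Δ : ℝ} (hκ : κ ≠ 0) (hΔ : 0 < Δ) :
    ‖approx1 d j κ Δ‖ = 1 := by
  rw [approx1_eq_normalize, NormedSpace.norm_normalize_eq_one_iff]
  exact gaussianComb_ne_zero (summable_inv_one_add_abs_peak_sq j) hκ hΔ 1

end Approximation1

/-! ### Approximation 3 -/

section Approximation3

theorem dampTerm_delta (β y : ℝ) (n : ℕ) :
    dampTerm β (TemperedDistribution.delta y) n =
      ((Real.exp (-β * (n + 1 / 2)) * fockReal n y : ℝ) : ℂ) • ket (fock n) := by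
  rw [dampTerm, TemperedDistribution.delta_apply, fock_apply, Complex.ofReal_mul]

theorem exp_mul_mul_exp_le {β : ℝ} (hβ : 0 < β) (n : ℕ) :
    Real.exp (-β * (n + 1 / 2)) * Real.exp (β / 4 * n) * Real.exp (β / 4 * n) ≤
      Real.exp (-(β / 2)) ^ n := by
  rw [← Real.exp_add, ← Real.exp_add, ← Real.exp_nat_mul, Real.exp_le_exp]
  linarith

theorem exists_norm_dampTerm_delta_le {β : ℝ} (hβ : 0 < β) : ∃ B τ : ℝ, 0 < τ ∧ ∀ y n,
    ‖dampTerm β (TemperedDistribution.delta y) n‖ ≤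
      B * (Real.exp (-(β / 2)) ^ n * Real.exp (-τ * y ^ 2)) := by
  obtain ⟨B, τ, hB, hτ, h_fock⟩ := exists_abs_fockReal_le (ε := β / 4) (by positivity)
  obtain ⟨B', hB', h_ket⟩ := exists_norm_ket_fock_le (ε := β / 4) (by positivity)
  refine ⟨B * B', τ, hτ, fun y n => ?_⟩
  rw [dampTerm_delta, norm_smul, Complex.norm_real, Real.norm_eq_abs, abs_mul, Real.abs_exp]
  calc Real.exp (-β * (n + 1 / 2)) * |fockReal n y| * ‖ket (fock n)‖
      ≤ Real.exp (-β * (n + 1 / 2)) * (B * Real.exp (β / 4 * n) * Real.exp (-τ * y ^ 2)) *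
          (B' * Real.exp (β / 4 * n)) := by
        gcongr
        exacts [h_fock n y, h_ket n]
    _ = B * B' * ((Real.exp (-β * (n + 1 / 2)) * Real.exp (β / 4 * n) * Real.exp (β / 4 * n)) *
          Real.exp (-τ * y ^ 2)) := by ring
    _ ≤ B * B' * (Real.exp (-(β / 2)) ^ n * Real.exp (-τ * y ^ 2)) := by
        gcongr
        exact exp_mul_mul_exp_le hβ n

theorem summable_exp_neg_pow {β : ℝ} (hβ : 0 < β) :
    Summable fun n : ℕ => Real.exp (-(β / 2)) ^ n :=
  summable_geometric_of_lt_one (Real.exp_pos _).le (by simpa using hβ)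

/-- The factor between Mehler's kernel and the Gaussian peak it is proportional to. -/
noncomputable def mehlerFactor (β : ℝ) : ℝ := (√(2 * π * Real.sinh β) * peakHeight √(Real.tanh β))⁻¹

theorem mehlerFactor_pos {β : ℝ} (hβ : 0 < β) : 0 < mehlerFactor β := by
  have := Real.sinh_pos_iff.2 hβ
  have h_height := peakHeight_pos (Real.sqrt_pos.2 (tanh_pos hβ))
  unfold mehlerFactor
  positivity

theorem ofReal_mehlerKernel {β : ℝ} (hβ : 0 < β) (x y : ℝ) :
    (mehlerKernel β x y : ℂ) =
      mehlerFactor β * gaussianPeak √(Real.tanh β) √(Real.tanh β) (Real.cosh β)⁻¹ y x := by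
  have := Real.sinh_pos_iff.2 hβ
  have := Real.cosh_pos β
  have h_tanh := tanh_pos hβ
  have h_height := (peakHeight_pos (Real.sqrt_pos.2 h_tanh)).ne'
  have h_exponent : -(Real.cosh β * (x ^ 2 + y ^ 2) - 2 * x * y) / (2 * Real.sinh β) =
      -(Real.tanh β * y ^ 2 / 2 + (x - (Real.cosh β)⁻¹ * y) ^ 2 / (2 * Real.tanh β)) := by
    rw [Real.tanh_eq_sinh_div_cosh]
    field_simp
    linear_combination -y ^ 2 * Real.cosh_sq β
  rw [gaussianPeak_apply _ (Real.sqrt_pos.2 h_tanh), ← Complex.ofReal_mul, mehlerKernel,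
    mehlerFactor, h_exponent, Real.sq_sqrt h_tanh.le, mul_inv, mul_assoc _⁻¹ _⁻¹,
    inv_mul_cancel_left₀ h_height]

theorem hasSum_dampTerm_delta {β : ℝ} (hβ : 0 < β) (y : ℝ) :
    HasSum (dampTerm β (TemperedDistribution.delta y)) ((mehlerFactor β : ℂ) •
      ket (gaussianPeak √(Real.tanh β) √(Real.tanh β) (Real.cosh β)⁻¹ y)) := by
  have h_term : dampTerm β (TemperedDistribution.delta y) = fun n : ℕ =>
      ket (((Real.exp (-β * (n + 1 / 2)) * fockReal n y : ℝ) : ℂ) • fock n) :=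
    funext fun n => by rw [dampTerm_delta, ket_smul]
  obtain ⟨B, τ, -, h_le⟩ := exists_norm_dampTerm_delta_le hβ
  replace h_le := h_le y
  rw [h_term] at h_le
  rw [h_term, ← ket_smul]
  refine hasSum_ket (Summable.of_nonneg_of_le (fun n => norm_nonneg _) h_le
    (((summable_exp_neg_pow hβ).mul_right _).mul_left _)) fun x => ?_
  rw [smul_apply, smul_eq_mul, ← ofReal_mehlerKernel hβ]
  refine (Complex.hasSum_ofReal.2 (hasSum_mehlerKernel hβ x y)).congr_fun fun n => ?_
  rw [smul_apply, fock_apply, smul_eq_mul]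
  push_cast
  ring

variable {ι : Type*} {y : ι → ℝ}

theorem hasSum_dampTerm_diracComb (hy : Summable fun i => ((1 + |y i|) ^ 2)⁻¹) {β : ℝ}
    (hβ : 0 < β) : HasSum (dampTerm β (diracComb hy)) ((mehlerFactor β : ℂ) •
      gaussianComb y √(Real.tanh β) √(Real.tanh β) (Real.cosh β)⁻¹) := by
  obtain ⟨B, τ, hτ, h_le⟩ := exists_norm_dampTerm_delta_le hβ
  have h_double : Summable fun p : ι × ℕ =>
      dampTerm β (TemperedDistribution.delta (y p.1)) p.2 := by
    refine Summable.of_norm_bounded (((summable_exp_neg_mul_sq hy hτ).mul_of_nonneg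
      (summable_exp_neg_pow hβ) (fun i => by positivity) (fun n => by positivity)).mul_left B)
      fun p => ?_
    rw [mul_comm (Real.exp _)]
    exact h_le _ _
  have h_total : ∑' p : ι × ℕ, dampTerm β (TemperedDistribution.delta (y p.1)) p.2 =
      (mehlerFactor β : ℂ) • gaussianComb y √(Real.tanh β) √(Real.tanh β) (Real.cosh β)⁻¹ :=
    (h_double.hasSum.prod_fiberwise fun i => hasSum_dampTerm_delta hβ (y i)).unique
      ((hasSum_gaussianComb hy (Real.sqrt_pos.2 (tanh_pos hβ)).ne' _ _).const_smul _)
  have h_fiber : ∀ n, HasSum (fun i => dampTerm β (TemperedDistribution.delta (y i)) n)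
      (dampTerm β (diracComb hy) n) := fun n =>
    ((hasSum_diracComb_apply hy (fock n)).mul_left _).smul_const _
  have h_swap : HasSum (fun p : ℕ × ι => dampTerm β (TemperedDistribution.delta (y p.2)) p.1)
      (∑' p : ι × ℕ, dampTerm β (TemperedDistribution.delta (y p.1)) p.2) :=
    (Equiv.prodComm ℕ ι).hasSum_iff.2 h_double.hasSum
  rw [← h_total]
  exact HasSum.prod_fiberwise h_swap h_fiber

theorem hasSum_dampTerm_ideal {d : ℕ} (j : Fin d) {β : ℝ} (hβ : 0 < β) :
    HasSum (dampTerm β (ideal d j)) (((√(spacing d * d) * mehlerFactor β : ℝ) : ℂ) •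
      gaussianComb (peak d j) √(Real.tanh β) √(Real.tanh β) (Real.cosh β)⁻¹) := by
  have h := (hasSum_dampTerm_diracComb (summable_inv_one_add_abs_peak_sq j) hβ).const_smul
    ((√(spacing d * d) : ℝ) : ℂ)
  rw [smul_smul, ← Complex.ofReal_mul] at h
  refine h.congr_fun fun n => ?_
  rw [dampTerm, dampTerm, ideal_eq_smul_diracComb, smul_apply, smul_eq_mul, smul_smul,
    mul_left_comm]

theorem approx3_eq_normalize {d : ℕ} (j : Fin d) {β : ℝ} (hβ : 0 < β) :
    approx3 d j β = NormedSpace.normalize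
      (gaussianComb (peak d j) √(Real.tanh β) √(Real.tanh β) (Real.cosh β)⁻¹) := by
  rw [approx3, damp, (hasSum_dampTerm_ideal j hβ).tsum_eq, normalize_ofReal_smul
    (mul_pos (Real.sqrt_pos.2 (spacing_mul_pos j)) (mehlerFactor_pos hβ))]

end Approximation3

/-! ### Approximation 2 -/

section Approximation2

/-- The weight `(2πγδ)⁻¹ e^{-r₁²/(2γ²) - r₂²/(2δ²)}` of the displacement `V̂(r)`. -/
noncomputable def gaussianWeight (γ δ : ℝ) (r : ℝ × ℝ) : ℝ :=
  1 / (2 * π * γ * δ) * Real.exp (-(r.1 ^ 2 / (2 * γ ^ 2)) - r.2 ^ 2 / (2 * δ ^ 2))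

/-- The Gaussian-weighted displacement of a generalized ket `T`, tested against `f`; for
`T = ideal d j` this is `approx2Integrand`. -/
noncomputable def weylIntegrand (γ δ : ℝ) (T : 𝓢'(ℝ, ℂ)) (f : 𝓢(ℝ, ℂ)) (r : ℝ × ℝ) : ℂ :=
  (gaussianWeight γ δ r : ℂ) * dispV r T f

theorem dispV_delta_apply (r : ℝ × ℝ) (y : ℝ) (f : 𝓢(ℝ, ℂ)) :
    dispV r (TemperedDistribution.delta y) f =
      Complex.exp (((r.1 * (y + r.2 / 2) : ℝ) : ℂ) * Complex.I) * f (y + r.2) := by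
  change Complex.exp (-Complex.I * r.1 * r.2 / 2) * dispX (-r.2) (dispZ r.1 f) y = _
  rw [dispX_apply, dispZ_apply, sub_neg_eq_add, ← mul_assoc, ← Complex.exp_add]
  push_cast
  ring_nf

theorem continuous_weylIntegrand_delta (γ δ y : ℝ) (f : 𝓢(ℝ, ℂ)) :
    Continuous (weylIntegrand γ δ (TemperedDistribution.delta y) f) := by
  have hf := f.continuous
  unfold weylIntegrand gaussianWeight
  simp only [dispV_delta_apply]
  fun_prop

theorem integrable_gaussianWeight_mul {γ δ : ℝ} (hγ : γ ≠ 0) (hδ : δ ≠ 0) :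
    Integrable fun r : ℝ × ℝ => gaussianWeight γ δ r * (1 + |r.2|) ^ 2 := by
  set τ := 1 / (4 * δ ^ 2) with hτ
  have hτ_pos : 0 < τ := by positivity
  have h_fst : Integrable fun u : ℝ => Real.exp (-(1 / (2 * γ ^ 2)) * u ^ 2) :=
    integrable_exp_neg_mul_sq (by positivity)
  have h_snd : Integrable fun t : ℝ => Real.exp (-(2 * τ) * t ^ 2) * (1 + |t|) ^ 2 := by
    refine ((integrable_exp_neg_mul_sq hτ_pos).const_mul (2 * (1 + τ⁻¹))).mono'
      (by fun_prop) (ae_of_all _ fun t => ?_)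
    rw [Real.norm_of_nonneg (by positivity)]
    calc Real.exp (-(2 * τ) * t ^ 2) * (1 + |t|) ^ 2
        ≤ Real.exp (-(2 * τ) * t ^ 2) * (2 * (1 + τ⁻¹) * Real.exp (τ * t ^ 2)) := by
          gcongr
          exact one_add_abs_sq_le hτ_pos t
      _ = 2 * (1 + τ⁻¹) * Real.exp (-τ * t ^ 2) := by
          rw [mul_left_comm, ← Real.exp_add]
          ring_nf
  refine ((h_fst.mul_prod h_snd).const_mul (1 / (2 * π * γ * δ))).congr (ae_of_all _ fun r => ?_)
  simp only [gaussianWeight, sub_eq_add_neg, Real.exp_add, hτ]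
  ring_nf

theorem inv_one_add_abs_add_sq_le (y t : ℝ) :
    ((1 + |y + t|) ^ 2)⁻¹ ≤ (1 + |t|) ^ 2 * ((1 + |y|) ^ 2)⁻¹ := by
  rw [← div_eq_mul_inv, le_div_iff₀ (by positivity), inv_mul_le_iff₀ (by positivity), ← mul_pow]
  gcongr
  have h_abs : |y| ≤ |y + t| + |t| := by simpa using abs_sub (y + t) t
  nlinarith [mul_nonneg (abs_nonneg (y + t)) (abs_nonneg t)]

theorem norm_weylIntegrand_delta_le (γ δ : ℝ) {f : 𝓢(ℝ, ℂ)} {C : ℝ} (hC : 0 ≤ C)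
    (hf : ∀ x, ‖f x‖ ≤ C * ((1 + |x|) ^ 2)⁻¹) (y : ℝ) (r : ℝ × ℝ) :
    ‖weylIntegrand γ δ (TemperedDistribution.delta y) f r‖ ≤
      C * ‖gaussianWeight γ δ r * (1 + |r.2|) ^ 2‖ * ((1 + |y|) ^ 2)⁻¹ := by
  rw [weylIntegrand, dispV_delta_apply, norm_mul, norm_mul, Complex.norm_exp_ofReal_mul_I, one_mul,
    Complex.norm_real, norm_mul, Real.norm_of_nonneg (sq_nonneg (1 + |r.2|))]
  calc ‖gaussianWeight γ δ r‖ * ‖f (y + r.2)‖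
      ≤ ‖gaussianWeight γ δ r‖ * (C * ((1 + |r.2|) ^ 2 * ((1 + |y|) ^ 2)⁻¹)) := by
        gcongr
        exact (hf _).trans (by gcongr; exact inv_one_add_abs_add_sq_le y r.2)
    _ = C * (‖gaussianWeight γ δ r‖ * (1 + |r.2|) ^ 2) * ((1 + |y|) ^ 2)⁻¹ := by ring

theorem integrable_weylIntegrand_delta {γ δ : ℝ} (hγ : γ ≠ 0) (hδ : δ ≠ 0) (y : ℝ)
    (f : 𝓢(ℝ, ℂ)) : Integrable (weylIntegrand γ δ (TemperedDistribution.delta y) f) := by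
  obtain ⟨C, hC, hf⟩ := exists_norm_le_mul_inv f
  exact (((integrable_gaussianWeight_mul hγ hδ).norm.const_mul C).mul_const _).mono'
    (continuous_weylIntegrand_delta γ δ y f).aestronglyMeasurable
    (ae_of_all _ fun r => norm_weylIntegrand_delta_le γ δ hC hf y r)

section Comb

variable {ι : Type*} {y : ι → ℝ}

theorem hasSum_weylIntegrand_diracComb (hy : Summable fun i => ((1 + |y i|) ^ 2)⁻¹) (γ δ : ℝ)
    (f : 𝓢(ℝ, ℂ)) (r : ℝ × ℝ) :
    HasSum (fun i => weylIntegrand γ δ (TemperedDistribution.delta (y i)) f r)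
      (weylIntegrand γ δ (diracComb hy) f r) :=
  ((hasSum_diracComb_apply hy (dispX (-r.2) (dispZ r.1 f))).mul_left _).mul_left _

variable [Countable ι]

theorem integrable_weylIntegrand_diracComb (hy : Summable fun i => ((1 + |y i|) ^ 2)⁻¹) {γ δ : ℝ}
    (hγ : γ ≠ 0) (hδ : δ ≠ 0) (f : 𝓢(ℝ, ℂ)) :
    Integrable (weylIntegrand γ δ (diracComb hy) f) := by
  obtain ⟨C, hC, hf⟩ := exists_norm_le_mul_inv f
  refine (((integrable_gaussianWeight_mul hγ hδ).norm.const_mul C).mul_const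
    (∑' i, ((1 + |y i|) ^ 2)⁻¹)).mono' ?_ (ae_of_all _ fun r => ?_)
  · exact aestronglyMeasurable_of_tendsto_ae (u := (atTop : Filter (Finset ι)))
      (f := fun S r => ∑ i ∈ S, weylIntegrand γ δ (TemperedDistribution.delta (y i)) f r)
      (fun S => (continuous_finsetSum S fun i _ =>
        continuous_weylIntegrand_delta γ δ (y i) f).aestronglyMeasurable)
      (ae_of_all _ fun r => hasSum_weylIntegrand_diracComb hy γ δ f r)
  · rw [← (hasSum_weylIntegrand_diracComb hy γ δ f r).tsum_eq]
    exact tsum_of_norm_bounded (hy.hasSum.mul_left _) fun i =>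
      norm_weylIntegrand_delta_le γ δ hC hf (y i) r

theorem hasSum_integral_weylIntegrand (hy : Summable fun i => ((1 + |y i|) ^ 2)⁻¹) {γ δ : ℝ}
    (hγ : γ ≠ 0) (hδ : δ ≠ 0) (f : 𝓢(ℝ, ℂ)) :
    HasSum (fun i => ∫ r, weylIntegrand γ δ (TemperedDistribution.delta (y i)) f r)
      (∫ r, weylIntegrand γ δ (diracComb hy) f r) := by
  obtain ⟨C, hC, hf⟩ := exists_norm_le_mul_inv f
  refine hasSum_integral_of_dominated_convergence _
    (fun i => (continuous_weylIntegrand_delta γ δ (y i) f).aestronglyMeasurable)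
    (fun i => ae_of_all _ (norm_weylIntegrand_delta_le γ δ hC hf (y i)))
    (ae_of_all _ fun r => hy.mul_left _) ?_
    (ae_of_all _ (hasSum_weylIntegrand_diracComb hy γ δ f))
  simp only [tsum_mul_left]
  exact ((integrable_gaussianWeight_mul hγ hδ).norm.const_mul C).mul_const _

end Comb

theorem lam_pos (γ δ : ℝ) : 0 < lam γ δ := by
  unfold lam
  positivity

/-- The factor `μ = 1 - γ²δ²/(2λ)` by which the averaged displacements move the peaks towards the
origin. -/
noncomputable def contraction (γ δ : ℝ) : ℝ := 1 - γ ^ 2 * δ ^ 2 / (2 * lam γ δ)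

/-- The factor between the averaged displacement of a position ket and the Gaussian peak it is
proportional to. -/
noncomputable def weylFactor (γ δ : ℝ) : ℝ :=
  √(2 * π * γ ^ 2) / (2 * π * (γ * δ) * peakHeight √(δ ^ 2 / lam γ δ))

section Kernel

variable {γ δ : ℝ}

theorem sqrt_sq_div_lam_pos {a : ℝ} (ha : a ≠ 0) (γ δ : ℝ) : 0 < √(a ^ 2 / lam γ δ) := by
  have := lam_pos γ δ
  positivity

theorem weylFactor_pos (hγδ : 0 < γ * δ) : 0 < weylFactor γ δ := by
  have hγ := left_ne_zero_of_mul hγδ.ne'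
  have h_height := peakHeight_pos (sqrt_sq_div_lam_pos (right_ne_zero_of_mul hγδ.ne') γ δ)
  unfold weylFactor
  positivity

theorem weyl_exponent_eq (hδ : δ ≠ 0) (x y : ℝ) :
    (x - y) ^ 2 / (2 * δ ^ 2) + γ ^ 2 * ((x + y) / 2) ^ 2 / 2 =
      γ ^ 2 / lam γ δ * y ^ 2 / 2 + (x - contraction γ δ * y) ^ 2 / (2 * (δ ^ 2 / lam γ δ)) := by
  have : 4 + γ ^ 2 * δ ^ 2 ≠ 0 := by positivity
  have h_eq : lam γ δ = (4 + γ ^ 2 * δ ^ 2) / 4 := by rw [lam]; ring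
  rw [contraction, h_eq]
  field_simp
  ring

theorem integral_weylIntegrand_delta_fst (hγ : γ ≠ 0) (y t : ℝ) (f : 𝓢(ℝ, ℂ)) :
    ∫ u, weylIntegrand γ δ (TemperedDistribution.delta y) f (u, t) =
      ((1 / (2 * π * γ * δ) * √(2 * π * γ ^ 2) *
        Real.exp (-(t ^ 2 / (2 * δ ^ 2) + γ ^ 2 * (y + t / 2) ^ 2 / 2)) : ℝ) : ℂ) * f (y + t) := by
  have h_integrand : ∀ u : ℝ, weylIntegrand γ δ (TemperedDistribution.delta y) f (u, t) =
      (1 / (2 * π * γ * δ) : ℝ) * f (y + t) *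
        Complex.exp (-(1 / (2 * γ ^ 2) : ℝ) * u ^ 2 + ((y + t / 2 : ℝ) * Complex.I) * u +
          (-(t ^ 2 / (2 * δ ^ 2)) : ℝ)) := by
    intro u
    have h_exp : Complex.exp (-(1 / (2 * γ ^ 2) : ℝ) * u ^ 2 +
          ((y + t / 2 : ℝ) * Complex.I) * u + (-(t ^ 2 / (2 * δ ^ 2)) : ℝ)) =
        (Real.exp (-(u ^ 2 / (2 * γ ^ 2)) - t ^ 2 / (2 * δ ^ 2)) : ℝ) *
          Complex.exp ((u * (y + t / 2) : ℝ) * Complex.I) := by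
      rw [Complex.ofReal_exp, ← Complex.exp_add]
      congr 1
      push_cast
      ring
    rw [h_exp, weylIntegrand, dispV_delta_apply, gaussianWeight]
    push_cast
    ring
  have h_width : π / (1 / (2 * γ ^ 2)) = 2 * π * γ ^ 2 := by field_simp
  have h_square : ((-(t ^ 2 / (2 * δ ^ 2)) : ℝ) : ℂ) +
      (((y + t / 2 : ℝ) : ℂ) * Complex.I) ^ 2 / (4 * (1 / (2 * γ ^ 2) : ℝ)) =
        ((-(t ^ 2 / (2 * δ ^ 2) + γ ^ 2 * (y + t / 2) ^ 2 / 2) : ℝ) : ℂ) := by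
    have : (γ : ℂ) ≠ 0 := Complex.ofReal_ne_zero.2 hγ
    rw [mul_pow, Complex.I_sq]
    push_cast
    field_simp
    ring
  simp only [h_integrand]
  rw [integral_const_mul, integral_cexp_quadratic_real (by positivity), h_width, h_square]
  push_cast
  ring

theorem integral_weylIntegrand_delta (hγ : γ ≠ 0) (hδ : δ ≠ 0) (y : ℝ) (f : 𝓢(ℝ, ℂ)) :
    ∫ r, weylIntegrand γ δ (TemperedDistribution.delta y) f r =
      (weylFactor γ δ : ℂ) * ∫ x, f x *
        gaussianPeak √(γ ^ 2 / lam γ δ) √(δ ^ 2 / lam γ δ) (contraction γ δ) y x := by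
  have h_lam := lam_pos γ δ
  have h_width := sqrt_sq_div_lam_pos hδ γ δ
  have h_height := (peakHeight_pos h_width).ne'
  have h_int := integrable_weylIntegrand_delta hγ hδ y f
  rw [Measure.volume_eq_prod] at h_int ⊢
  rw [integral_prod_symm _ h_int, ← integral_const_mul, ← integral_add_left_eq_self
    (fun x => (weylFactor γ δ : ℂ) * (f x * gaussianPeak _ _ _ y x)) y]
  refine integral_congr_ae (ae_of_all _ fun t => ?_)
  dsimp only
  have h_exponent := weyl_exponent_eq (γ := γ) hδ (y + t) y
  rw [add_sub_cancel_left, show (y + t + y) / 2 = y + t / 2 by ring] at h_exponent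
  have h_real : 1 / (2 * π * γ * δ) * √(2 * π * γ ^ 2) =
      weylFactor γ δ * peakHeight √(δ ^ 2 / lam γ δ) := by
    rw [weylFactor]
    field_simp
  rw [integral_weylIntegrand_delta_fst hγ, gaussianPeak_apply _ h_width, Real.sq_sqrt
    (by positivity), Real.sq_sqrt (by positivity), h_exponent, h_real]
  push_cast
  ring

end Kernel

theorem IsApprox2Integral.unique {d : ℕ} {j : Fin d} {γ δ : ℝ} {φ ψ : H}
    (hφ : IsApprox2Integral d j γ δ φ) (hψ : IsApprox2Integral d j γ δ ψ) : φ = ψ :=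
  toTemperedDistribution_injective fun f => (hφ f).trans (hψ f).symm

theorem approx2Integral_eq {d : ℕ} {j : Fin d} {γ δ : ℝ} {ψ : H}
    (hψ : IsApprox2Integral d j γ δ ψ) : approx2Integral d j γ δ = ψ := by
  have h : ∃ ψ, IsApprox2Integral d j γ δ ψ := ⟨ψ, hψ⟩
  rw [approx2Integral, dif_pos h]
  exact h.choose_spec.unique hψ

section Lattice

variable {d : ℕ} (j : Fin d) {γ δ : ℝ}

theorem approx2Integrand_eq (γ δ : ℝ) (f : 𝓢(ℝ, ℂ)) :
    approx2Integrand d j γ δ f = fun r => ((√(spacing d * d) : ℝ) : ℂ) *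
      weylIntegrand γ δ (diracComb (summable_inv_one_add_abs_peak_sq j)) f r := by
  ext1 r
  rw [approx2Integrand, ideal_eq_smul_diracComb, map_smul, smul_apply, smul_eq_mul, weylIntegrand,
    mul_left_comm, gaussianWeight]

theorem integrable_approx2Integrand (hγ : γ ≠ 0) (hδ : δ ≠ 0) (f : 𝓢(ℝ, ℂ)) :
    Integrable (approx2Integrand d j γ δ f) := by
  rw [approx2Integrand_eq]
  exact (integrable_weylIntegrand_diracComb _ hγ hδ f).const_mul _

theorem isApprox2Integral_gaussianComb (hγ : γ ≠ 0) (hδ : δ ≠ 0) :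
    IsApprox2Integral d j γ δ (((√(spacing d * d) * weylFactor γ δ : ℝ) : ℂ) • gaussianComb
      (peak d j) √(γ ^ 2 / lam γ δ) √(δ ^ 2 / lam γ δ) (contraction γ δ)) := by
  intro f
  have h_comb := hasSum_toTemperedDistribution ((hasSum_gaussianComb
    (summable_inv_one_add_abs_peak_sq j) (sqrt_sq_div_lam_pos hγ γ δ).ne' √(δ ^ 2 / lam γ δ)
    (contraction γ δ)).const_smul ((√(spacing d * d) * weylFactor γ δ : ℝ) : ℂ)) f
  have h_integral := (hasSum_integral_weylIntegrand (summable_inv_one_add_abs_peak_sq j) hγ hδ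
    f).mul_left ((√(spacing d * d) : ℝ) : ℂ)
  rw [approx2Integrand_eq, integral_const_mul]
  refine h_comb.unique (h_integral.congr_fun fun s => ?_)
  rw [← ket_smul, toTemperedDistribution_ket, integral_weylIntegrand_delta hγ hδ, ← mul_assoc,
    ← Complex.ofReal_mul, ← integral_const_mul]
  simp only [smul_apply, smul_eq_mul, mul_left_comm]

theorem existsUnique_isApprox2Integral (hγ : γ ≠ 0) (hδ : δ ≠ 0) :
    ∃! ψ, IsApprox2Integral d j γ δ ψ :=
  ⟨_, isApprox2Integral_gaussianComb j hγ hδ,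
    fun _ hψ => hψ.unique (isApprox2Integral_gaussianComb j hγ hδ)⟩

theorem approx2_eq_normalize (hγδ : 0 < γ * δ) :
    approx2 d j γ δ = NormedSpace.normalize (gaussianComb (peak d j) √(γ ^ 2 / lam γ δ)
      √(δ ^ 2 / lam γ δ) (contraction γ δ)) := by
  rw [approx2, approx2Integral_eq (isApprox2Integral_gaussianComb j (left_ne_zero_of_mul hγδ.ne')
      (right_ne_zero_of_mul hγδ.ne')), normalize_ofReal_smul
    (mul_pos (Real.sqrt_pos.2 (spacing_mul_pos j)) (weylFactor_pos hγδ))]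

theorem norm_approx2 (hγδ : 0 < γ * δ) : ‖approx2 d j γ δ‖ = 1 := by
  rw [approx2_eq_normalize j hγδ, NormedSpace.norm_normalize_eq_one_iff]
  exact gaussianComb_ne_zero (summable_inv_one_add_abs_peak_sq j)
    (sqrt_sq_div_lam_pos (left_ne_zero_of_mul hγδ.ne') γ δ).ne'
    (sqrt_sq_div_lam_pos (right_ne_zero_of_mul hγδ.ne') γ δ) _

end Lattice

end Approximation2

/-! ### Matching the parameters -/

section Parameters

variable {κ Δ γ δ β : ℝ}

theorem contraction_pos (hγδ : 0 < γ * δ) (hγδ_lt : γ * δ < 2) : 0 < contraction γ δ := by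
  have h_lam := lam_pos γ δ
  rw [contraction, sub_pos, div_lt_one (by positivity), lam]
  nlinarith [mul_pos hγδ hγδ]

theorem sqrt_one_add_sq_mul_sq (hγδ : 0 < γ * δ) (hγδ_lt : γ * δ < 2)
    (hκ : κ ^ 2 = γ ^ 2 / lam γ δ)
    (hΔ : Δ ^ 2 = δ ^ 2 / lam γ δ * (contraction γ δ ^ 2)⁻¹) :
    √(1 + κ ^ 2 * Δ ^ 2) = (contraction γ δ)⁻¹ := by
  have h_lam := lam_pos γ δ
  have h_pos := contraction_pos hγδ hγδ_lt
  have h_sum : lam γ δ ^ 2 * contraction γ δ ^ 2 + γ ^ 2 * δ ^ 2 = lam γ δ ^ 2 := by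
    rw [contraction]
    field_simp
    rw [lam]
    ring
  rw [Real.sqrt_eq_iff_eq_sq (by positivity) (by positivity), hκ, hΔ]
  field_simp
  linear_combination h_sum

theorem squeezeH_approx1_eq_approx2 {d : ℕ} (j : Fin d) (hκ_pos : 0 < κ) (hΔ_pos : 0 < Δ)
    (hγδ : 0 < γ * δ) (hγδ_lt : γ * δ < 2) (hκ : κ ^ 2 = γ ^ 2 / lam γ δ)
    (hΔ : Δ ^ 2 = δ ^ 2 / lam γ δ * (contraction γ δ ^ 2)⁻¹) :
    squeezeH (Real.log √(1 + κ ^ 2 * Δ ^ 2)) (approx1 d j κ Δ) = approx2 d j γ δ := by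
  have h_pos := contraction_pos hγδ hγδ_lt
  have h_width : √(δ ^ 2 / lam γ δ) = Δ * contraction γ δ := by
    rw [← Real.sqrt_sq (mul_pos hΔ_pos h_pos).le, mul_pow, hΔ,
      inv_mul_cancel_right₀ (pow_ne_zero 2 h_pos.ne')]
  rw [sqrt_one_add_sq_mul_sq hγδ hγδ_lt hκ hΔ, squeezeH_approx1 j hκ_pos.ne' hΔ_pos
    (inv_pos.2 h_pos), approx2_eq_normalize j hγδ, ← hκ, Real.sqrt_sq hκ_pos.le, h_width,
    div_inv_eq_mul, one_div, inv_inv]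

theorem sinh_eq_two_mul_half (β : ℝ) :
    Real.sinh β = 2 * Real.sinh (β / 2) * Real.cosh (β / 2) := by
  rw [← Real.sinh_two_mul, mul_div_cancel₀ β two_ne_zero]

theorem cosh_eq_sq_add_sq_half (β : ℝ) :
    Real.cosh β = Real.cosh (β / 2) ^ 2 + Real.sinh (β / 2) ^ 2 := by
  rw [← Real.cosh_two_mul, mul_div_cancel₀ β two_ne_zero]

theorem div_lam_eq_tanh (hγ : γ ^ 2 = 2 * Real.tanh (β / 2)) (hδ : δ ^ 2 = 2 * Real.tanh (β / 2)) :
    γ ^ 2 / lam γ δ = Real.tanh β := by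
  have := Real.cosh_pos (β / 2)
  rw [lam, hγ, hδ, Real.tanh_eq_sinh_div_cosh, Real.tanh_eq_sinh_div_cosh, sinh_eq_two_mul_half β,
    cosh_eq_sq_add_sq_half β]
  field_simp
  ring

theorem contraction_eq_inv_cosh (hγ : γ ^ 2 = 2 * Real.tanh (β / 2))
    (hδ : δ ^ 2 = 2 * Real.tanh (β / 2)) : contraction γ δ = (Real.cosh β)⁻¹ := by
  have := Real.cosh_pos (β / 2)
  have : 0 < Real.cosh (β / 2) ^ 2 + Real.sinh (β / 2) ^ 2 := by positivity
  rw [contraction, lam, hγ, hδ, Real.tanh_eq_sinh_div_cosh, cosh_eq_sq_add_sq_half β]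
  field_simp
  linear_combination
    4 * (Real.cosh (β / 2) ^ 2 + Real.sinh (β / 2) ^ 2) * Real.cosh_sq (β / 2)

theorem div_lam_mul_inv_contraction_sq (hγ : γ ^ 2 = 2 * Real.tanh (β / 2))
    (hδ : δ ^ 2 = 2 * Real.tanh (β / 2)) :
    δ ^ 2 / lam γ δ * (contraction γ δ ^ 2)⁻¹ = Real.sinh β * Real.cosh β := by
  have := Real.cosh_pos β
  rw [contraction_eq_inv_cosh hγ hδ, hδ, ← hγ, div_lam_eq_tanh hγ hδ, Real.tanh_eq_sinh_div_cosh]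
  field_simp

theorem mul_lt_two_of_sq_eq_tanh (hγ : γ ^ 2 = 2 * Real.tanh (β / 2))
    (hδ : δ ^ 2 = 2 * Real.tanh (β / 2)) : γ * δ < 2 := by
  have h_tanh := Real.tanh_lt_one (β / 2)
  nlinarith [sq_nonneg (γ - δ)]

theorem approx2_eq_approx3 {d : ℕ} (j : Fin d) (hγδ : 0 < γ * δ) (hβ : 0 < β)
    (hγ : γ ^ 2 = 2 * Real.tanh (β / 2)) (hδ : δ ^ 2 = 2 * Real.tanh (β / 2)) :
    approx2 d j γ δ = approx3 d j β := by
  have h_width : δ ^ 2 / lam γ δ = Real.tanh β := by rw [hδ, ← hγ, div_lam_eq_tanh hγ hδ]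
  rw [approx2_eq_normalize j hγδ, approx3_eq_normalize j hβ, h_width, div_lam_eq_tanh hγ hδ,
    contraction_eq_inv_cosh hγ hδ]

end Parameters

end GKP

theorem theorem1 (d : ℕ) (j : Fin d) (κ Δ γ δ β : ℝ)
    (hκ : 0 < κ) (hΔ : 0 < Δ) (hγδ : 0 < γ * δ) (hβ : 0 < β)
    (hγ2 : γ ^ 2 = 2 * Real.tanh (β / 2)) (hδ2 : δ ^ 2 = 2 * Real.tanh (β / 2))
    (hκ2 : κ ^ 2 = γ ^ 2 / GKP.lam γ δ)
    (hΔ2 : Δ ^ 2 = δ ^ 2 / GKP.lam γ δ *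
      ((1 - γ ^ 2 * δ ^ 2 / (2 * GKP.lam γ δ)) ^ 2)⁻¹) :
    -- the prescriptions for the parameters agree and are admissible
    (γ ^ 2 / GKP.lam γ δ = Real.tanh β ∧
      δ ^ 2 / GKP.lam γ δ * ((1 - γ ^ 2 * δ ^ 2 / (2 * GKP.lam γ δ)) ^ 2)⁻¹ =
        Real.sinh β * Real.cosh β ∧
      γ * δ < 2) ∧
    -- the ideal state and the three approximations are well defined
    (Summable (fun s : ℤ =>
        (TemperedDistribution.delta (GKP.peak d j s) : TemperedDistribution ℝ ℂ)) ∧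
      Summable (GKP.approx1Term d j κ Δ) ∧
      (∀ f, MeasureTheory.Integrable (GKP.approx2Integrand d j γ δ f)) ∧
      (∃! ψ, GKP.IsApprox2Integral d j γ δ ψ) ∧
      Summable (GKP.dampTerm β (GKP.ideal d j)) ∧
      ‖GKP.approx1 d j κ Δ‖ = 1 ∧ ‖GKP.approx2 d j γ δ‖ = 1 ∧ ‖GKP.approx3 d j β‖ = 1) ∧
    -- the three states agree
    GKP.squeezeH (Real.log (Real.sqrt (1 + κ ^ 2 * Δ ^ 2))) (GKP.approx1 d j κ Δ) =
        GKP.approx2 d j γ δ ∧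
      GKP.approx2 d j γ δ = GKP.approx3 d j β := by
  have hγ : γ ≠ 0 := left_ne_zero_of_mul hγδ.ne'
  have hδ : δ ≠ 0 := right_ne_zero_of_mul hγδ.ne'
  have h_lt : γ * δ < 2 := GKP.mul_lt_two_of_sq_eq_tanh hγ2 hδ2
  have h_eq : GKP.approx2 d j γ δ = GKP.approx3 d j β :=
    GKP.approx2_eq_approx3 j hγδ hβ hγ2 hδ2
  refine ⟨⟨GKP.div_lam_eq_tanh hγ2 hδ2, GKP.div_lam_mul_inv_contraction_sq hγ2 hδ2, h_lt⟩,
    ⟨?ideal, ?series, ?integrable, ?weak, ?damped, ?norm₁, ?norm₂, ?norm₃⟩, ?squeezed, h_eq⟩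
  case ideal => exact (GKP.hasSum_delta (GKP.summable_inv_one_add_abs_peak_sq j)).summable
  case series => exact GKP.summable_approx1Term j hκ.ne' Δ
  case integrable => exact GKP.integrable_approx2Integrand j hγ hδ
  case weak => exact GKP.existsUnique_isApprox2Integral j hγ hδ
  case damped => exact (GKP.hasSum_dampTerm_ideal j hβ).summable
  case norm₁ => exact GKP.norm_approx1 j hκ.ne' hΔ
  case norm₂ => exact GKP.norm_approx2 j hγδ
  case norm₃ => exact h_eq ▸ GKP.norm_approx2 j hγδ
  case squeezed => exact GKP.squeezeH_approx1_eq_approx2 j hκ hΔ hγδ h_lt hκ2 hΔ2
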